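/- Let $n\ge 1$, $1<p<q<\infty$ and $0<\alpha<n$. A weight on $\mathbb R^n$ is a locally integrable function which is positive and finite almost everywhere; for a weight $v$ put $v(E)=\int_E v(x)\,dx$. Let $v\in A_\infty=\bigcup_{1\le s<\infty}A_s$ (Muckenhoupt classes, defined over cubes with sides parallel to the axes), and suppose that $v$ satisfies the reverse doubling condition $RD_\beta$ of order $\beta=q(1-\alpha/n)$: there is a constant $c$ such that $$\frac{v(B')}{v(B)}\le c\left(\frac{|B'|}{|B|}\right)^{\beta}\qquad\text{for all balls } B'\subset B .$$ Let $\omega$ be a positive continuous function on $(0,\infty)$. For nonnegative locally integrable $f$ on $\mathbb R^n$ let $$I_\alpha f(x)=\int_{\mathbb R^n}\frac{f(y)\,dy}{|x-y|^{n-\alpha}},\qquad M_\alpha f(x)=\sup_{r>0}\frac{1}{|B(x,r)|^{1-\alpha/n}}\int_{B(x,r)}f(y)\,dy,$$ and for measurable $F:\mathbb R^n\to[0,\infty]$ let $$\|F\|_{\dot{\mathcal M}_{p,\omega}(\mathbb R^n,v)}=\sup_{r>0}\,\omega(r)\left(\int_{B(0,r)}F(x)^p\,v(x)\,dx\right)^{1/p}\in[0,\infty].$$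 For $r>0$ put $u(r)=\omega(r)\,v(B(0,r))^{1/p}$ and $$U(r)=\sup_{t>r}\,t^{\alpha-n}\sup_{0<s<t}u(s)\in(0,\infty].$$ Then the following two statements are equivalent. (a) There is a constant $C>0$ such that, for every nonnegative locally integrable function $f$ on $\mathbb R^n$, $$\|I_\alpha f\|_{\dot{\mathcal M}_{p,\omega}(\mathbb R^n,v)}\le C\,\|M_\alpha f\|_{\dot{\mathcal M}_{p,\omega}(\mathbb R^n,v)}\quad\text{and}\quad \|M_\alpha f\|_{\dot{\mathcal M}_{p,\omega}(\mathbb R^n,v)}\le C\,\|I_\alpha f\|_{\dot{\mathcal M}_{p,\omega}(\mathbb R^n,v)}.$$ (b) $$\sup_{r>0}\; r^{n-\alpha}\,U(r)\int_r^\infty t^{\alpha-n-1}\,U(t)^{-1}\,dt<\infty,$$ with the conventions $\infty^{-1}=0$ and $\infty\cdot 0=0$. -/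

import Mathlib

open MeasureTheory Set
open scoped ENNReal NNReal

noncomputable section

namespace MorreyRiesz

/-- The Euclidean space `ℝⁿ` with its Euclidean norm. -/
abbrev Rn (n : ℕ) : Type := EuclideanSpace ℝ (Fin n)

/-- A weight on `ℝⁿ`: a locally integrable function that is positive (and, being real valued,
finite) almost everywhere. -/
def IsWeight {n : ℕ} (v : Rn n → ℝ) : Prop :=
  LocallyIntegrable v volume ∧ ∀ᵐ x : Rn n, 0 < v x

/-- The measure `v(E) = ∫_E v(x) dx` associated with a weight. -/
def wMeasure {n : ℕ} (v : Rn n → ℝ) : Measure (Rn n) :=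
  (volume : Measure (Rn n)).withDensity (fun x => ENNReal.ofReal (v x))

/-- The cube with centre `x`, side length `2 r` and sides parallel to the axes. -/
def cube {n : ℕ} (x : Rn n) (r : ℝ) : Set (Rn n) :=
  {y | ∀ i, |y i - x i| ≤ r}

/-- Muckenhoupt's condition `A_p` for `1 < p < ∞`; here `1 - p' = -1 / (p - 1)`. -/
def MuckenhouptAp {n : ℕ} (p : ℝ) (v : Rn n → ℝ) : Prop :=
  ∃ C : ℝ≥0, ∀ (x : Rn n) (r : ℝ), 0 < r →
    (∫⁻ y in cube x r, ENNReal.ofReal (v y)) *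
        (∫⁻ y in cube x r, ENNReal.ofReal (v y) ^ (-1 / (p - 1))) ^ (p - 1)
      ≤ C * volume (cube x r) ^ p

/-- Muckenhoupt's condition `A_1`. -/
def MuckenhouptA1 {n : ℕ} (v : Rn n → ℝ) : Prop :=
  ∃ C : ℝ≥0, ∀ (x : Rn n) (r : ℝ), 0 < r →
    (∫⁻ y in cube x r, ENNReal.ofReal (v y)) / volume (cube x r)
      ≤ C * essInf (fun y => ENNReal.ofReal (v y)) (volume.restrict (cube x r))

/-- The class `A_∞`, the union of the classes `A_p` over `1 ≤ p < ∞`. -/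
def MuckenhouptAinfty {n : ℕ} (v : Rn n → ℝ) : Prop :=
  IsWeight v ∧ (MuckenhouptA1 v ∨ ∃ p : ℝ, 1 < p ∧ MuckenhouptAp p v)

/-- The reverse doubling class `RD_β`: `v(B') / v(B) ≤ c (|B'| / |B|)^β` for all balls
`B' ⊆ B`. -/
def ReverseDoubling {n : ℕ} (β : ℝ) (v : Rn n → ℝ) : Prop :=
  IsWeight v ∧ ∃ c : ℝ≥0, ∀ (x x' : Rn n) (r r' : ℝ), 0 < r → 0 < r' →
    Metric.ball x' r' ⊆ Metric.ball x r →
      wMeasure v (Metric.ball x' r') / wMeasure v (Metric.ball x r)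
        ≤ c * (volume (Metric.ball x' r') / volume (Metric.ball x r)) ^ β

/-- A continuous weight on `(0, ∞)`: a positive continuous function on `(0, ∞)` (its values
outside `(0, ∞)` are never used). -/
def IsContWeight (ω : ℝ → ℝ) : Prop :=
  ContinuousOn ω (Ioi 0) ∧ ∀ r, 0 < r → 0 < ω r

/-- The Riesz potential `I_α f(x) = ∫ f(y) |x - y|^{α - n} dy` of a nonnegative `f`, with values
in `[0, ∞]`. -/
def rieszPotential {n : ℕ} (α : ℝ) (f : Rn n → ℝ) (x : Rn n) : ℝ≥0∞ :=
  ∫⁻ y, ENNReal.ofReal (f y) / ENNReal.ofReal (‖x - y‖ ^ ((n : ℝ) - α))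

/-- The fractional maximal function
`M_α f(x) = sup_{r > 0} |B(x,r)|^{α/n - 1} ∫_{B(x,r)} f` of a nonnegative `f`, with values
in `[0, ∞]`. -/
def fracMaximal {n : ℕ} (α : ℝ) (f : Rn n → ℝ) (x : Rn n) : ℝ≥0∞ :=
  ⨆ (r : ℝ) (_ : 0 < r),
    (∫⁻ y in Metric.ball x r, ENNReal.ofReal (f y)) /
      volume (Metric.ball x r) ^ (1 - α / (n : ℝ))

/-- The weighted norm `‖F‖_{L_p(E, v)} = (∫_E F(x)^p v(x) dx)^{1/p}` of a `[0, ∞]`-valued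
function. -/
def wLpNorm {n : ℕ} (p : ℝ) (v : Rn n → ℝ) (E : Set (Rn n)) (F : Rn n → ℝ≥0∞) : ℝ≥0∞ :=
  (∫⁻ x in E, F x ^ p * ENNReal.ofReal (v x)) ^ (1 / p)

/-- The quasinorm `sup_{r > 0} ω(r) ‖F‖_{L_p(B(0,r), v)}` of the generalized weighted central
Morrey space, for a `[0, ∞]`-valued function; it is `∞` outside the space. -/
def centralMorreyNorm {n : ℕ} (p : ℝ) (ω : ℝ → ℝ) (v : Rn n → ℝ) (F : Rn n → ℝ≥0∞) : ℝ≥0∞ :=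
  ⨆ (r : ℝ) (_ : 0 < r), ENNReal.ofReal (ω r) * wLpNorm p v (Metric.ball 0 r) F

/-- `u(r) = ω(r) v(B(0,r))^{1/p}`. -/
def uFun {n : ℕ} (p : ℝ) (ω : ℝ → ℝ) (v : Rn n → ℝ) (r : ℝ) : ℝ≥0∞ :=
  ENNReal.ofReal (ω r) * wMeasure v (Metric.ball 0 r) ^ (1 / p)

/-- `U(r) = sup_{t > r} t^{α - n} sup_{0 < s < t} u(s)`, a value in `[0, ∞]`. -/
def UFun {n : ℕ} (p α : ℝ) (ω : ℝ → ℝ) (v : Rn n → ℝ) (r : ℝ) : ℝ≥0∞ :=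
  ⨆ (t : ℝ) (_ : r < t),
    ENNReal.ofReal (t ^ (α - (n : ℝ))) * ⨆ (s : ℝ) (_ : 0 < s ∧ s < t), uFun p ω v s

end MorreyRiesz

end

/-!
Write `γ = n - α`, `F(t) = ∫_{B(0, t)} f`, and let `V` be the measure `v dx`.

On a ball `B = B(0, r)` both operators reduce to one-dimensional expressions in `F`. The part of
`f` outside `B(0, 2r)` contributes to `I_α f`, up to constants and uniformly on `B`, at most the
truncated potential `∫ max(|y|, r) ^ (-γ) f(y) dy = γ ∫_r^∞ t ^ (-γ - 1) F(t) dt`, and to `M_α f`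
at most the truncated maximal function `sup_{t > r} t ^ (-γ) F(t)`; these are also lower bounds for
`I_α f` and `M_α f` on `B`. The part of `f` inside `B(0, 2r)` is harmless: reverse doubling, with
`p < q`, makes `|x - y| ^ (-γ p)` integrable against `V` near the diagonal
(`exists_lintegral_kernel_rpow_le`), so Hölder and Tonelli bound its potential in `L_p(B, v)` by
`V(B) ^ (1/p) r ^ (-γ) F(2r)` (`exists_lintegral_measPotential_restrict_le`), and this is at most
either truncated expression times `V(B) ^ (1/p)`. The condition `A_∞` enters through the doubling
property (`exists_doubling`). Hence, up to constants (`exists_centralMorreyNorm_le`, `uFun_mul_truncPotential_le`,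
`uFun_mul_truncMaximal_le`),

* `‖I_α f‖ ≈ sup_r u(r) ∫_r^∞ t ^ (-γ - 1) F(t) dt`,
* `‖M_α f‖ ≈ sup_r u(r) sup_{t > r} t ^ (-γ) F(t) ≈ sup_t U(t) F(t)`.

The inequality `‖M_α f‖ ≤ C ‖I_α f‖` follows from `M_α f ≤ C I_α f`. If the supremum over `r` of the
quantity in the condition on `U` (`hardyQuantity`) is finite, inserting `F ≤ A / U` into the first
expression and using `u(r) ≤ r ^ γ U(r)` gives the other inequality
(`uFun_mul_truncPotential_le_of_hardyQuantity_le`). Conversely one tests with functions for which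
`F` is comparable, up to a dilation, to `1 / U` cut off near the origin
(`exists_measure_ball_comparable`); the bound on the tail integrals obtained in this way is upgraded
to the required one in `hardyQuantity_le`, by splitting the integral at the radius that nearly
attains the supremum `U(r)`. This last step also covers `U = ∞`, where the quantity is `∞ * 0 = 0`.
-/

namespace MorreyRiesz

/-! ### Power integrals and the layer-cake formula -/

lemma ofReal_rpow_neg_eq_scale {a c : ℝ} (γ : ℝ) (ha : 0 < a) (hc : 0 < c) :
    ENNReal.ofReal (a ^ (-γ)) = ENNReal.ofReal (c ^ γ) * ENNReal.ofReal ((c * a) ^ (-γ)) := by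
  rw [← ENNReal.ofReal_mul (by positivity), Real.mul_rpow hc.le ha.le, ← mul_assoc,
    ← Real.rpow_add hc, add_neg_cancel, Real.rpow_zero, one_mul]

lemma inv_ofReal_rpow {a : ℝ} (γ : ℝ) (ha : 0 < a) :
    (ENNReal.ofReal (a ^ γ))⁻¹ = ENNReal.ofReal (a ^ (-γ)) := by
  rw [← ENNReal.ofReal_inv_of_pos (by positivity), Real.rpow_neg ha.le]

lemma ofReal_rpow_neg_le {a b γ : ℝ} (ha : 0 < a) (hab : a ≤ b) (hγ : 0 < γ) :
    ENNReal.ofReal (b ^ (-γ)) ≤ ENNReal.ofReal (a ^ (-γ)) :=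
  ENNReal.ofReal_le_ofReal (Real.rpow_le_rpow_of_nonpos ha hab (by linarith))

lemma lintegral_Ioi_rpow {a γ : ℝ} (ha : 0 < a) (hγ : 0 < γ) :
    ∫⁻ t in Ioi a, ENNReal.ofReal (t ^ (-γ - 1))
      = ENNReal.ofReal γ⁻¹ * ENNReal.ofReal (a ^ (-γ)) := by
  rw [← ofReal_integral_eq_lintegral_ofReal (integrableOn_Ioi_rpow_of_lt (by linarith) ha),
    integral_Ioi_rpow_of_lt (by linarith) ha, ← ENNReal.ofReal_mul (by positivity)]
  · congr 1
    rw [sub_add_cancel]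
    field_simp
  · filter_upwards [ae_restrict_mem measurableSet_Ioi] with t ht
    exact Real.rpow_nonneg (ha.trans ht).le _

lemma lintegral_Ioc_rpow {R s : ℝ} (hR : 0 < R) (hs : 0 < s) :
    ∫⁻ t in Ioc 0 R, ENNReal.ofReal (t ^ (s - 1)) = ENNReal.ofReal (s⁻¹ * R ^ s) := by
  have hint : IntegrableOn (fun t : ℝ => t ^ (s - 1)) (Ioc 0 R) := by
    rw [← intervalIntegrable_iff_integrableOn_Ioc_of_le hR.le]
    exact intervalIntegral.intervalIntegrable_rpow' (by linarith)
  rw [← ofReal_integral_eq_lintegral_ofReal hint, ← intervalIntegral.integral_of_le hR.le,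
    integral_rpow (Or.inl (by linarith))]
  · congr 1
    rw [sub_add_cancel, Real.zero_rpow hs.ne']
    field_simp
    simp
  · filter_upwards [ae_restrict_mem measurableSet_Ioc] with t ht
    exact Real.rpow_nonneg ht.1.le _

/-- Layer-cake formula for the kernel `max(|x - y|, r) ^ (-γ)`: since
`a ^ (-γ) = γ ∫_a^∞ t ^ (-γ - 1) dt`, Tonelli's theorem trades it for the growth of
`t ↦ μ (B(y, t))`. -/
lemma lintegral_Ioi_rpow_mul_measure_ball {n : ℕ} (μ : Measure (Rn n)) [SFinite μ] {γ r : ℝ}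
    (hγ : 0 < γ) (y : Rn n) (h : ∀ᵐ x ∂μ, 0 < max ‖x - y‖ r) :
    ∫⁻ t in Ioi r, ENNReal.ofReal (t ^ (-γ - 1)) * μ (Metric.ball y t)
      = ENNReal.ofReal γ⁻¹ * ∫⁻ x, ENNReal.ofReal ((max ‖x - y‖ r) ^ (-γ)) ∂μ := by
  have hmeas : Measurable (Function.uncurry fun (t : ℝ) (x : Rn n) =>
      (Metric.ball y t).indicator (fun _ => ENNReal.ofReal (t ^ (-γ - 1))) x) := by
    have : (Function.uncurry fun (t : ℝ) (x : Rn n) =>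
        (Metric.ball y t).indicator (fun _ => ENNReal.ofReal (t ^ (-γ - 1))) x)
        = {z : ℝ × Rn n | dist z.2 y < z.1}.indicator
            (fun z => ENNReal.ofReal (z.1 ^ (-γ - 1))) := by
      ext ⟨t, x⟩
      simp [Function.uncurry, indicator]
    rw [this]
    refine Measurable.indicator (by fun_prop) ?_
    exact measurableSet_lt (by fun_prop) (by fun_prop)
  calc ∫⁻ t in Ioi r, ENNReal.ofReal (t ^ (-γ - 1)) * μ (Metric.ball y t)
      = ∫⁻ t in Ioi r, ∫⁻ x,
          (Metric.ball y t).indicator (fun _ => ENNReal.ofReal (t ^ (-γ - 1))) x ∂μ := by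
        refine lintegral_congr fun t => ?_
        rw [lintegral_indicator_const Metric.isOpen_ball.measurableSet]
    _ = ∫⁻ x, (∫⁻ t in Ioi r,
          (Metric.ball y t).indicator (fun _ => ENNReal.ofReal (t ^ (-γ - 1))) x) ∂μ :=
        lintegral_lintegral_swap hmeas.aemeasurable
    _ = ∫⁻ x, ENNReal.ofReal γ⁻¹ * ENNReal.ofReal ((max ‖x - y‖ r) ^ (-γ)) ∂μ := by
        refine lintegral_congr_ae ?_
        filter_upwards [h] with x hx
        rw [← lintegral_Ioi_rpow hx hγ, ← Ioi_inter_Ioi,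
          ← setLIntegral_indicator measurableSet_Ioi]
        refine lintegral_congr fun t => ?_
        simp [indicator, dist_eq_norm]
    _ = _ := lintegral_const_mul' _ _ ENNReal.ofReal_ne_top

/-- The special case `(∫ g) ^ p ≤ μ(univ) ^ (p - 1) ∫ g ^ p` of Hölder's inequality. -/
lemma lintegral_rpow_le_measure_univ_mul {X : Type*} [MeasurableSpace X] (μ : Measure X) {p : ℝ}
    (hp : 1 < p) {g : X → ℝ≥0∞} (hg : AEMeasurable g μ) :
    (∫⁻ x, g x ∂μ) ^ p ≤ μ univ ^ (p - 1) * ∫⁻ x, g x ^ p ∂μ := by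
  have hp0 : 0 < p := by linarith
  have hpq := Real.HolderConjugate.conjExponent hp
  have H := ENNReal.lintegral_mul_le_Lp_mul_Lq μ hpq hg (aemeasurable_const (b := (1 : ℝ≥0∞)))
  have H' := ENNReal.rpow_le_rpow H hp0.le
  simp only [Pi.mul_apply, mul_one, ENNReal.one_rpow, lintegral_const, one_mul] at H'
  rw [ENNReal.mul_rpow_of_nonneg _ _ hp0.le, ← ENNReal.rpow_mul, ← ENNReal.rpow_mul,
    one_div_mul_cancel hp0.ne', ENNReal.rpow_one, mul_comm] at H'
  have e : 1 / p.conjExponent * p = p - 1 := by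
    have : p - 1 ≠ 0 := by linarith
    rw [Real.conjExponent]
    field_simp
  rwa [e] at H'

/-! ### Potentials and maximal functions of measures -/

/-- The Riesz potential `∫ |x - y| ^ (-γ) dμ(y)` of a measure. The kernel is written as an inverse
in `[0, ∞]`, so that it is `∞` on the diagonal. -/
noncomputable def measPotential {n : ℕ} (γ : ℝ) (μ : Measure (Rn n)) (x : Rn n) : ℝ≥0∞ :=
  ∫⁻ y, (ENNReal.ofReal (‖x - y‖ ^ γ))⁻¹ ∂μ

/-- The fractional maximal function `sup_{r > 0} r ^ (-γ) μ(B(x, r))` of a measure. -/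
noncomputable def measMaximal {n : ℕ} (γ : ℝ) (μ : Measure (Rn n)) (x : Rn n) : ℝ≥0∞ :=
  ⨆ (r : ℝ) (_ : 0 < r), ENNReal.ofReal (r ^ (-γ)) * μ (Metric.ball x r)

/-- The truncated potential `∫ max(|y|, r) ^ (-γ) dμ(y)` at the origin. -/
noncomputable def truncPotential {n : ℕ} (γ : ℝ) (μ : Measure (Rn n)) (r : ℝ) : ℝ≥0∞ :=
  ∫⁻ y, ENNReal.ofReal ((max ‖y‖ r) ^ (-γ)) ∂μ

/-- The truncated maximal function `sup_{t > r} t ^ (-γ) μ(B(0, t))` at the origin. -/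
noncomputable def truncMaximal {n : ℕ} (γ : ℝ) (μ : Measure (Rn n)) (r : ℝ) : ℝ≥0∞ :=
  ⨆ (t : ℝ) (_ : r < t), ENNReal.ofReal (t ^ (-γ)) * μ (Metric.ball 0 t)

section Pointwise

variable {n : ℕ} {γ r : ℝ} {x : Rn n} (μ : Measure (Rn n))

lemma lintegral_Ioi_eq_truncPotential [SFinite μ] (hγ : 0 < γ) (hr : 0 < r) :
    ∫⁻ t in Ioi r, ENNReal.ofReal (t ^ (-γ - 1)) * μ (Metric.ball 0 t)
      = ENNReal.ofReal γ⁻¹ * truncPotential γ μ r := by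
  rw [lintegral_Ioi_rpow_mul_measure_ball μ hγ 0 (ae_of_all _ fun x => lt_max_of_lt_right hr)]
  simp [truncPotential]

lemma measMaximal_le_measPotential (hγ : 0 < γ) (x : Rn n) :
    measMaximal γ μ x ≤ measPotential γ μ x := by
  refine iSup₂_le fun r hr => ?_
  calc ENNReal.ofReal (r ^ (-γ)) * μ (Metric.ball x r)
      = ∫⁻ _ in Metric.ball x r, ENNReal.ofReal (r ^ (-γ)) ∂μ := by simp
    _ ≤ ∫⁻ y in Metric.ball x r, (ENNReal.ofReal (‖x - y‖ ^ γ))⁻¹ ∂μ := by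
        refine setLIntegral_mono' Metric.isOpen_ball.measurableSet fun y hy => ?_
        rw [← inv_ofReal_rpow γ hr, ENNReal.inv_le_inv]
        rw [Metric.mem_ball, dist_comm, dist_eq_norm] at hy
        exact ENNReal.ofReal_le_ofReal (Real.rpow_le_rpow (norm_nonneg _) hy.le hγ.le)
    _ ≤ _ := setLIntegral_le_lintegral _ _

lemma truncMaximal_le_measMaximal (hx : ‖x‖ < r) :
    truncMaximal γ μ r ≤ ENNReal.ofReal (2 ^ γ) * measMaximal γ μ x := by
  refine iSup₂_le fun t ht => ?_
  have ht0 : 0 < t := (norm_nonneg x).trans_lt (hx.trans ht)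
  rw [ofReal_rpow_neg_eq_scale γ ht0 two_pos, mul_assoc]
  gcongr
  refine le_trans ?_ (le_iSup₂ (f := fun (r : ℝ) (_ : 0 < r) =>
    ENNReal.ofReal (r ^ (-γ)) * μ (Metric.ball x r)) (2 * t) (by positivity))
  gcongr
  refine Metric.ball_subset_ball' ?_
  rw [dist_zero_left]
  linarith

/-- Balls of radius less than `r` around a point of `B(0, r)` see only the mass in `B(0, 2r)`; the
larger ones are comparable to balls around the origin. -/
lemma measMaximal_le_add (hγ : 0 < γ) (hx : ‖x‖ < r) :
    measMaximal γ μ x ≤ measPotential γ (μ.restrict (Metric.ball 0 (2 * r))) x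
      + ENNReal.ofReal (2 ^ γ) * truncMaximal γ μ r := by
  refine iSup₂_le fun s hs => ?_
  rcases lt_or_ge s r with hsr | hsr
  · refine le_add_right (le_trans ?_ (measMaximal_le_measPotential _ hγ x))
    refine le_trans (le_of_eq ?_) (le_iSup₂ (f := fun (s : ℝ) (_ : 0 < s) =>
      ENNReal.ofReal (s ^ (-γ)) * μ.restrict (Metric.ball 0 (2 * r)) (Metric.ball x s)) s hs)
    rw [Measure.restrict_apply Metric.isOpen_ball.measurableSet, inter_eq_left.2]
    refine Metric.ball_subset_ball' ?_
    rw [dist_zero_right]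
    linarith
  · refine le_add_left ?_
    rw [ofReal_rpow_neg_eq_scale γ hs two_pos, mul_assoc]
    gcongr
    refine le_trans ?_ (le_iSup₂ (f := fun (t : ℝ) (_ : r < t) =>
      ENNReal.ofReal (t ^ (-γ)) * μ (Metric.ball 0 t)) (2 * s) (by linarith))
    gcongr
    refine Metric.ball_subset_ball' ?_
    rw [dist_zero_right]
    linarith

lemma truncPotential_le_measPotential (hγ : 0 < γ) (hx : ‖x‖ < r) :
    truncPotential γ μ r ≤ ENNReal.ofReal (2 ^ γ) * measPotential γ μ x := by
  have hr : 0 < r := (norm_nonneg x).trans_lt hx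
  rw [truncPotential, measPotential, ← lintegral_const_mul' _ _ ENNReal.ofReal_ne_top]
  refine lintegral_mono fun y => ?_
  have hm : 0 < max ‖y‖ r := lt_max_of_lt_right hr
  rw [ofReal_rpow_neg_eq_scale γ hm two_pos, ← inv_ofReal_rpow γ (by positivity : 0 < 2 * max ‖y‖ r)]
  gcongr
  calc ‖x - y‖ ≤ ‖x‖ + ‖y‖ := norm_sub_le _ _
    _ ≤ max ‖y‖ r + max ‖y‖ r := add_le_add (hx.le.trans (le_max_right _ _)) (le_max_left _ _)
    _ = _ := by ring

lemma measPotential_le_add (hγ : 0 < γ) (hx : ‖x‖ < r) :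
    measPotential γ μ x ≤ measPotential γ (μ.restrict (Metric.ball 0 (2 * r))) x
      + ENNReal.ofReal (2 ^ γ) * truncPotential γ μ r := by
  have hr : 0 < r := (norm_nonneg x).trans_lt hx
  have hball : MeasurableSet (Metric.ball (0 : Rn n) (2 * r)) := Metric.isOpen_ball.measurableSet
  rw [measPotential, ← lintegral_add_compl _ hball]
  refine add_le_add le_rfl ?_
  rw [truncPotential, ← lintegral_const_mul' _ _ ENNReal.ofReal_ne_top]
  refine le_trans (setLIntegral_mono' hball.compl fun y hy => ?_) (setLIntegral_le_lintegral _ _)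
  have hy' : 2 * r ≤ ‖y‖ := by simpa using hy
  have hm : max ‖y‖ r = ‖y‖ := max_eq_left (by linarith)
  have hy0 : 0 < ‖y‖ := by linarith
  have e : ENNReal.ofReal (2 ^ γ) * ENNReal.ofReal (‖y‖ ^ (-γ))
      = (ENNReal.ofReal ((‖y‖ / 2) ^ γ))⁻¹ := by
    rw [inv_ofReal_rpow γ (by positivity),
      ofReal_rpow_neg_eq_scale γ (by positivity : 0 < ‖y‖ / 2) two_pos]
    congr 4
    ring
  rw [hm, e]
  gcongr
  have := norm_sub_norm_le y x
  rw [norm_sub_rev] at this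
  linarith

lemma measure_ball_two_mul_le_truncPotential (hγ : 0 < γ) (hr : 0 < r) :
    ENNReal.ofReal (r ^ (-γ)) * μ (Metric.ball 0 (2 * r))
      ≤ ENNReal.ofReal (2 ^ γ) * truncPotential γ μ r := by
  rw [ofReal_rpow_neg_eq_scale γ hr two_pos, mul_assoc]
  gcongr
  calc _ = ∫⁻ _ in Metric.ball 0 (2 * r), ENNReal.ofReal ((2 * r) ^ (-γ)) ∂μ := by simp
    _ ≤ ∫⁻ y in Metric.ball 0 (2 * r), ENNReal.ofReal ((max ‖y‖ r) ^ (-γ)) ∂μ := by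
        refine setLIntegral_mono' Metric.isOpen_ball.measurableSet fun y hy => ?_
        refine ofReal_rpow_neg_le (lt_max_of_lt_right hr) ?_ hγ
        exact max_le (mem_ball_zero_iff.1 hy).le (by linarith)
    _ ≤ _ := setLIntegral_le_lintegral _ _

lemma measure_ball_two_mul_le_truncMaximal (hr : 0 < r) :
    ENNReal.ofReal (r ^ (-γ)) * μ (Metric.ball 0 (2 * r))
      ≤ ENNReal.ofReal (2 ^ γ) * truncMaximal γ μ r := by
  rw [ofReal_rpow_neg_eq_scale γ hr two_pos, mul_assoc]
  gcongr
  exact le_iSup₂ (f := fun (t : ℝ) (_ : r < t) =>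
      ENNReal.ofReal (t ^ (-γ)) * μ (Metric.ball 0 t)) (2 * r) (by linarith)

end Pointwise

/-! ### The operators of the statement in terms of measures -/

lemma wMeasure_apply {n : ℕ} (f : Rn n → ℝ) {E : Set (Rn n)} (hE : MeasurableSet E) :
    wMeasure f E = ∫⁻ x in E, ENNReal.ofReal (f x) :=
  withDensity_apply _ hE

lemma rieszPotential_eq_measPotential {n : ℕ} {f : Rn n → ℝ} (α : ℝ)
    (hf : AEMeasurable f volume) (x : Rn n) :
    rieszPotential α f x = measPotential ((n : ℝ) - α) (wMeasure f) x := by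
  have hk : Measurable fun y : Rn n => (ENNReal.ofReal (‖x - y‖ ^ ((n : ℝ) - α)))⁻¹ := by fun_prop
  rw [measPotential, wMeasure, lintegral_withDensity_eq_lintegral_mul₀ hf.ennreal_ofReal
    hk.aemeasurable]
  rfl

lemma volume_ball_rpow {n : ℕ} (hn : n ≠ 0) (α : ℝ) (x : Rn n) {r : ℝ} (hr : 0 < r) :
    volume (Metric.ball x r) ^ (1 - α / (n : ℝ))
      = ENNReal.ofReal (r ^ ((n : ℝ) - α)) * volume (Metric.ball (0 : Rn n) 1) ^ (1 - α / (n : ℝ)) := by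
  have hn' : (n : ℝ) ≠ 0 := by exact_mod_cast hn
  rw [Measure.addHaar_ball_of_pos volume x hr, finrank_euclideanSpace_fin,
    ENNReal.mul_rpow_of_ne_top ENNReal.ofReal_ne_top measure_ball_lt_top.ne,
    ENNReal.ofReal_rpow_of_pos (by positivity), ← Real.rpow_natCast, ← Real.rpow_mul hr.le]
  congr 4
  field_simp

lemma volume_unitBall_rpow_ne_zero (n : ℕ) (s : ℝ) :
    volume (Metric.ball (0 : Rn n) 1) ^ s ≠ 0 :=
  (ENNReal.rpow_pos (Metric.measure_ball_pos _ _ one_pos) measure_ball_lt_top.ne).ne'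

lemma volume_unitBall_rpow_ne_top (n : ℕ) (s : ℝ) :
    volume (Metric.ball (0 : Rn n) 1) ^ s ≠ ∞ :=
  ENNReal.rpow_ne_top_of_ne_zero (Metric.measure_ball_pos _ _ one_pos).ne' measure_ball_lt_top.ne

lemma fracMaximal_eq_measMaximal {n : ℕ} (hn : n ≠ 0) (α : ℝ) (f : Rn n → ℝ) (x : Rn n) :
    fracMaximal α f x = (volume (Metric.ball (0 : Rn n) 1) ^ (1 - α / (n : ℝ)))⁻¹
      * measMaximal ((n : ℝ) - α) (wMeasure f) x := by
  simp only [fracMaximal, measMaximal, ENNReal.mul_iSup]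
  refine iSup_congr fun r => iSup_congr fun hr => ?_
  rw [volume_ball_rpow hn α x hr, ← wMeasure_apply f Metric.isOpen_ball.measurableSet, div_eq_mul_inv,
    ENNReal.mul_inv (Or.inl (by simp; positivity)) (Or.inl ENNReal.ofReal_ne_top),
    inv_ofReal_rpow _ hr]
  ring

/-! ### Doubling of `A_∞` weights -/

lemma wMeasure_ball_lt_top {n : ℕ} {v : Rn n → ℝ} (hv : IsWeight v) (x : Rn n) (r : ℝ) :
    wMeasure v (Metric.ball x r) < ∞ := by
  rw [wMeasure_apply v Metric.isOpen_ball.measurableSet]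
  exact ((hv.1.integrableOn_isCompact (isCompact_closedBall x r)).mono_set
    Metric.ball_subset_closedBall).lintegral_lt_top

lemma wMeasure_ball_pos {n : ℕ} {v : Rn n → ℝ} (hv : IsWeight v) (x : Rn n) {r : ℝ}
    (hr : 0 < r) : 0 < wMeasure v (Metric.ball x r) := by
  have hle : volume (Metric.ball x r) ≤
      volume ({y | ENNReal.ofReal (v y) ≠ 0} ∩ Metric.ball x r) := by
    refine measure_mono_ae ?_
    filter_upwards [hv.2] with y hy hyb
    exact ⟨by simpa using hy, hyb⟩
  refine pos_iff_ne_zero.2 fun h => ?_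
  rw [wMeasure, withDensity_apply_eq_zero' hv.1.aestronglyMeasurable.aemeasurable.ennreal_ofReal]
    at h
  exact ((Metric.measure_ball_pos _ _ hr).trans_le hle).ne' h

lemma ball_subset_cube {n : ℕ} (x : Rn n) (r : ℝ) : Metric.ball x r ⊆ cube x r := by
  intro y hy i
  rw [Metric.mem_ball, dist_eq_norm] at hy
  exact ((PiLp.norm_apply_le (y - x) i).trans hy.le)

lemma cube_subset_closedBall {n : ℕ} (x : Rn n) {r : ℝ} (hr : 0 ≤ r) :
    cube x r ⊆ Metric.closedBall x (n * r) := by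
  intro y hy
  rw [Metric.mem_closedBall, EuclideanSpace.dist_eq]
  refine Real.sqrt_le_iff.2 ⟨by positivity, ?_⟩
  have h1 : ∑ i, dist (y i) (x i) ^ 2 ≤ ∑ _i : Fin n, r ^ 2 := by
    refine Finset.sum_le_sum fun i _ => ?_
    rw [Real.dist_eq]
    exact pow_le_pow_left₀ (abs_nonneg _) (hy i) 2
  refine h1.trans ?_
  simp only [Finset.sum_const, Finset.card_univ, Fintype.card_fin, nsmul_eq_mul, mul_pow]
  gcongr
  exact_mod_cast Nat.le_self_pow two_ne_zero n

lemma measurableSet_cube {n : ℕ} (x : Rn n) (r : ℝ) : MeasurableSet (cube x r) := by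
  have : cube x r = ⋂ i, {y : Rn n | |y i - x i| ≤ r} := by ext; simp [cube]
  rw [this]
  exact MeasurableSet.iInter fun i => measurableSet_le (by fun_prop) measurable_const

lemma volume_cube_lt_top {n : ℕ} (x : Rn n) {r : ℝ} (hr : 0 ≤ r) : volume (cube x r) < ∞ :=
  (measure_mono (cube_subset_closedBall x hr)).trans_lt measure_closedBall_lt_top

lemma exists_volume_cube_le {n : ℕ} : ∃ A : ℝ≥0∞, A ≠ ∞ ∧ ∀ r : ℝ, 0 < r →
    volume (cube (0 : Rn n) (3 * r)) ≤ A * volume (Metric.ball (0 : Rn n) r) := by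
  refine ⟨ENNReal.ofReal ((n * 3 + 1) ^ n), ENNReal.ofReal_ne_top, fun r hr => ?_⟩
  have h1 : cube (0 : Rn n) (3 * r) ⊆ Metric.ball 0 ((n * 3 + 1) * r) :=
    (cube_subset_closedBall 0 (by positivity)).trans
      (Metric.closedBall_subset_ball (by nlinarith))
  refine (measure_mono h1).trans (le_of_eq ?_)
  rw [Measure.addHaar_ball_mul_of_pos volume 0 (by positivity : (0 : ℝ) < n * 3 + 1),
    finrank_euclideanSpace_fin]

/-- Hölder's inequality applied to `1 = v ^ (1/p) v ^ (-1/p)` on `E`. -/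
lemma volume_rpow_le_of_isWeight {n : ℕ} {v : Rn n → ℝ} (hv : IsWeight v) {p : ℝ} (hp : 1 < p)
    (E : Set (Rn n)) :
    volume E ^ p ≤ (∫⁻ y in E, ENNReal.ofReal (v y)) *
      (∫⁻ y in E, ENNReal.ofReal (v y) ^ (-1 / (p - 1))) ^ (p - 1) := by
  have hp0 : 0 < p := by linarith
  have hp1 : p - 1 ≠ 0 := by linarith
  have hpq := Real.HolderConjugate.conjExponent hp
  have hvm : AEMeasurable (fun y => ENNReal.ofReal (v y)) (volume.restrict E) :=
    (hv.1.aestronglyMeasurable.aemeasurable.ennreal_ofReal).restrict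
  have H := ENNReal.lintegral_mul_le_Lp_mul_Lq (volume.restrict E) hpq
    (hvm.pow_const (1 / p)) (hvm.pow_const (-1 / p))
  have h1 : volume E = ∫⁻ y in E, ((fun y => ENNReal.ofReal (v y) ^ (1 / p)) *
      (fun y => ENNReal.ofReal (v y) ^ (-1 / p))) y := by
    rw [← setLIntegral_one]
    refine lintegral_congr_ae ?_
    filter_upwards [ae_restrict_of_ae hv.2] with y hy
    have h0 : ENNReal.ofReal (v y) ≠ 0 := by simpa using hy
    rw [Pi.mul_apply, ← ENNReal.rpow_add _ _ h0 ENNReal.ofReal_ne_top, ← add_div]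
    simp
  rw [← h1] at H
  have H' := ENNReal.rpow_le_rpow H hp0.le
  rw [ENNReal.mul_rpow_of_nonneg _ _ hp0.le, ← ENNReal.rpow_mul, ← ENNReal.rpow_mul] at H'
  simp only [← ENNReal.rpow_mul] at H'
  have e1 : 1 / p * p = 1 := by field_simp
  have e2 : -1 / p * p.conjExponent = -1 / (p - 1) := by rw [Real.conjExponent]; field_simp
  have e3 : 1 / p.conjExponent * p = p - 1 := by rw [Real.conjExponent]; field_simp
  rw [e1, e2, e3] at H'
  simpa using H'

/-- An `A_∞` weight is doubling. Both `A_p` and `A_1` bound the ratio `v(Q) / v(E)`, for `E ⊆ Q`,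
by a power of `|Q| / |E|`. -/
lemma exists_doubling {n : ℕ} {v : Rn n → ℝ} (hv : MuckenhouptAinfty v) :
    ∃ D : ℝ≥0∞, D ≠ ∞ ∧ ∀ r : ℝ, 0 < r →
      wMeasure v (Metric.ball (0 : Rn n) (3 * r)) ≤ D * wMeasure v (Metric.ball 0 r) := by
  obtain ⟨hw, hv⟩ := hv
  obtain ⟨A, hA, hAvol⟩ := exists_volume_cube_le (n := n)
  have hsub : ∀ r : ℝ, 0 < r → Metric.ball (0 : Rn n) r ⊆ cube 0 (3 * r) := fun r hr =>
    (Metric.ball_subset_ball (by linarith)).trans (ball_subset_cube 0 (3 * r))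
  rcases hv with ⟨C, hC⟩ | ⟨p, hp, C, hC⟩
  · refine ⟨C * A, ENNReal.mul_ne_top ENNReal.coe_ne_top hA, fun r hr => ?_⟩
    set E := Metric.ball (0 : Rn n) r
    set Q := cube (0 : Rn n) (3 * r)
    have hE0 : volume E ≠ 0 := (Metric.measure_ball_pos _ _ hr).ne'
    have hE1 : volume E ≠ ∞ := measure_ball_lt_top.ne
    have hQ0 : volume Q ≠ 0 := fun h => hE0 (measure_mono_null (hsub r hr) h)
    have hQ1 : volume Q ≠ ∞ := (volume_cube_lt_top _ (by positivity)).ne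
    set m := essInf (fun y => ENNReal.ofReal (v y)) (volume.restrict Q)
    have h1 : m * volume E ≤ wMeasure v E := by
      rw [wMeasure_apply v Metric.isOpen_ball.measurableSet, ← setLIntegral_const]
      refine lintegral_mono_ae (ae_mono (Measure.restrict_mono (hsub r hr) le_rfl) ?_)
      exact ae_essInf_le
    have h2 : wMeasure v Q ≤ C * m * volume Q := by
      rw [wMeasure_apply v (measurableSet_cube _ _)]
      exact (ENNReal.div_le_iff hQ0 hQ1).1 (hC 0 (3 * r) (by positivity))
    calc wMeasure v (Metric.ball 0 (3 * r)) ≤ wMeasure v Q := measure_mono (ball_subset_cube _ _)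
      _ ≤ C * m * volume Q := h2
      _ ≤ C * m * (A * volume E) := by gcongr; exact hAvol r hr
      _ = C * A * (m * volume E) := by ring
      _ ≤ C * A * wMeasure v E := by gcongr
  · have hp0 : 0 < p := by linarith
    refine ⟨C * A ^ p, ENNReal.mul_ne_top ENNReal.coe_ne_top
      (ENNReal.rpow_ne_top_of_nonneg hp0.le hA), fun r hr => ?_⟩
    set E := Metric.ball (0 : Rn n) r
    set Q := cube (0 : Rn n) (3 * r)
    have hE0 : volume E ^ p ≠ 0 :=
      (ENNReal.rpow_pos (Metric.measure_ball_pos _ _ hr) measure_ball_lt_top.ne).ne'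
    have hE1 : volume E ^ p ≠ ∞ := ENNReal.rpow_ne_top_of_nonneg hp0.le measure_ball_lt_top.ne
    have key : wMeasure v Q * volume E ^ p ≤ C * A ^ p * wMeasure v E * volume E ^ p := by
      calc wMeasure v Q * volume E ^ p
          ≤ wMeasure v Q * ((∫⁻ y in E, ENNReal.ofReal (v y)) *
              (∫⁻ y in Q, ENNReal.ofReal (v y) ^ (-1 / (p - 1))) ^ (p - 1)) := by
            refine mul_le_mul_right ((volume_rpow_le_of_isWeight hw hp E).trans ?_) _
            exact mul_le_mul_right (ENNReal.rpow_le_rpow (lintegral_mono_set (hsub r hr))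
              (by linarith)) _
        _ = wMeasure v E * ((∫⁻ y in Q, ENNReal.ofReal (v y)) *
              (∫⁻ y in Q, ENNReal.ofReal (v y) ^ (-1 / (p - 1))) ^ (p - 1)) := by
            rw [wMeasure_apply v (measurableSet_cube _ _),
              wMeasure_apply v Metric.isOpen_ball.measurableSet]
            ring
        _ ≤ wMeasure v E * (C * (A * volume E) ^ p) := by
            refine mul_le_mul_right ((hC 0 (3 * r) (by positivity)).trans ?_) _
            gcongr
            exact hAvol r hr
        _ = _ := by rw [ENNReal.mul_rpow_of_nonneg _ _ hp0.le]; ring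
    exact (measure_mono (ball_subset_cube _ _)).trans
      ((ENNReal.mul_le_mul_iff_left hE0 hE1).1 key)

/-- Reverse doubling and doubling together bound the mass of a small ball `B(y, t)`, centred near
`B(0, r)`, by the power `(t / r) ^ (q (n - α))` of the mass of `B(0, r)`. -/
lemma exists_measure_ball_le {n : ℕ} (hn : n ≠ 0) {q α : ℝ} {v : Rn n → ℝ}
    (hvA : MuckenhouptAinfty v) (hvRD : ReverseDoubling (q * (1 - α / (n : ℝ))) v) :
    ∃ C : ℝ≥0∞, C ≠ ∞ ∧ ∀ r t : ℝ, ∀ y : Rn n, 0 < t → t ≤ r → ‖y‖ < 2 * r →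
      wMeasure v (Metric.ball y t)
        ≤ C * ENNReal.ofReal ((t / r) ^ (q * ((n : ℝ) - α))) * wMeasure v (Metric.ball 0 r) := by
  obtain ⟨D, hD, hDv⟩ := exists_doubling hvA
  obtain ⟨hw, c, hc⟩ := hvRD
  refine ⟨c * D, ENNReal.mul_ne_top ENNReal.coe_ne_top hD, fun r t y ht htr hy => ?_⟩
  have hr : 0 < r := ht.trans_le htr
  have hn' : (n : ℝ) ≠ 0 := by exact_mod_cast hn
  have h := hc y y r t hr ht (Metric.ball_subset_ball htr)
  have hvol : volume (Metric.ball y t) / volume (Metric.ball y r)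
      = ENNReal.ofReal ((t / r) ^ (n : ℝ)) := by
    have e : t = t / r * r := by field_simp
    have h0 : volume (Metric.ball (0 : Rn n) r) ≠ 0 := (Metric.measure_ball_pos _ _ hr).ne'
    rw [e, Measure.addHaar_ball_mul_of_pos volume y (by positivity : 0 < t / r),
      Measure.addHaar_ball_center volume y r, finrank_euclideanSpace_fin,
      ENNReal.mul_div_cancel_right h0 measure_ball_lt_top.ne, ← e, Real.rpow_natCast]
  rw [hvol, ENNReal.ofReal_rpow_of_pos (by positivity), ← Real.rpow_mul (by positivity),
    ENNReal.div_le_iff (wMeasure_ball_pos hw y hr).ne' (wMeasure_ball_lt_top hw y r).ne] at h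
  have e2 : (n : ℝ) * (q * (1 - α / (n : ℝ))) = q * ((n : ℝ) - α) := by field_simp
  rw [e2] at h
  have h3 : wMeasure v (Metric.ball y r) ≤ D * wMeasure v (Metric.ball 0 r) := by
    refine le_trans (measure_mono (Metric.ball_subset_ball' ?_)) (hDv r hr)
    rw [dist_zero_right]
    linarith
  calc _ ≤ _ := h
    _ ≤ c * ENNReal.ofReal ((t / r) ^ (q * ((n : ℝ) - α))) *
        (D * wMeasure v (Metric.ball 0 r)) := by gcongr
    _ = _ := by ring

/-! ### The local part of the potential -/

/-- The power `p` of the kernel is `v`-integrable near the diagonal because `v(B(y, t))` decays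
faster than `t ^ (p γ)` as `t → 0`; this is where `p < q` enters. -/
lemma exists_lintegral_kernel_rpow_le {n : ℕ} (hn : n ≠ 0) {p q γ : ℝ} (hp : 0 < p) (hpq : p < q)
    (hγ : 0 < γ) {v : Rn n → ℝ}
    (hgrow : ∃ C : ℝ≥0∞, C ≠ ∞ ∧ ∀ r t : ℝ, ∀ y : Rn n, 0 < t → t ≤ r → ‖y‖ < 2 * r →
      wMeasure v (Metric.ball y t)
        ≤ C * ENNReal.ofReal ((t / r) ^ (q * γ)) * wMeasure v (Metric.ball 0 r)) :
    ∃ C : ℝ≥0∞, C ≠ ∞ ∧ ∀ r : ℝ, ∀ y : Rn n, 0 < r → ‖y‖ < 2 * r →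
      ∫⁻ x in Metric.ball 0 r, (ENNReal.ofReal (‖x - y‖ ^ γ))⁻¹ ^ p ∂(wMeasure v)
        ≤ C * wMeasure v (Metric.ball 0 r) * ENNReal.ofReal (r ^ (-γ)) ^ p := by
  obtain ⟨C, hC, hgrow⟩ := hgrow
  have : Nontrivial (Rn n) := by
    have : Nonempty (Fin n) := Fin.pos_iff_nonempty.1 (Nat.pos_of_ne_zero hn)
    infer_instance
  set δ := γ * p with hδ
  have hδ0 : 0 < δ := by positivity
  have hs : 0 < q * γ - δ := by rw [hδ]; nlinarith
  refine ⟨ENNReal.ofReal δ * (C * ENNReal.ofReal (q * γ - δ)⁻¹ + ENNReal.ofReal δ⁻¹), ?_,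
    fun r y hr hy => ?_⟩
  · exact ENNReal.mul_ne_top ENNReal.ofReal_ne_top (ENNReal.add_ne_top.2
      ⟨ENNReal.mul_ne_top hC ENNReal.ofReal_ne_top, ENNReal.ofReal_ne_top⟩)
  set V := wMeasure v (Metric.ball (0 : Rn n) r)
  set μ := (wMeasure v).restrict (Metric.ball 0 r) with hμ
  have : SFinite (wMeasure v) := by unfold wMeasure; infer_instance
  have hne : ∀ᵐ x ∂μ, x ≠ y := by
    refine ae_restrict_of_ae ((withDensity_absolutelyContinuous _ _).ae_le ?_)
    exact Measure.ae_ne volume y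
  have hpos : ∀ᵐ x ∂μ, 0 < max ‖x - y‖ 0 := by
    filter_upwards [hne] with x hx
    exact lt_max_of_lt_left (norm_pos_iff.2 (sub_ne_zero.2 hx))
  have hcake := lintegral_Ioi_rpow_mul_measure_ball μ hδ0 y hpos
  have hker : ∫⁻ x, (ENNReal.ofReal (‖x - y‖ ^ γ))⁻¹ ^ p ∂μ
      = ENNReal.ofReal δ * ∫⁻ t in Ioi 0, ENNReal.ofReal (t ^ (-δ - 1)) * μ (Metric.ball y t) := by
    rw [hcake, ← mul_assoc, ← ENNReal.ofReal_mul hδ0.le, mul_inv_cancel₀ hδ0.ne',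
      ENNReal.ofReal_one, one_mul]
    refine lintegral_congr_ae ?_
    filter_upwards [hne] with x hx
    have hx0 : 0 < ‖x - y‖ := norm_pos_iff.2 (sub_ne_zero.2 hx)
    rw [max_eq_left (norm_nonneg _), inv_ofReal_rpow _ hx0,
      ENNReal.ofReal_rpow_of_pos (by positivity), ← Real.rpow_mul hx0.le]
    congr 2
    rw [hδ]; ring
  have hsmall : ∫⁻ t in Ioc 0 r, ENNReal.ofReal (t ^ (-δ - 1)) * μ (Metric.ball y t)
      ≤ C * ENNReal.ofReal (q * γ - δ)⁻¹ * V * ENNReal.ofReal (r ^ (-δ)) := by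
    calc _ ≤ ∫⁻ t in Ioc 0 r, C * V * ENNReal.ofReal (r ^ (-(q * γ))) *
            ENNReal.ofReal (t ^ (q * γ - δ - 1)) := by
          refine setLIntegral_mono' measurableSet_Ioc fun t ht => ?_
          calc _ ≤ ENNReal.ofReal (t ^ (-δ - 1)) *
                (C * ENNReal.ofReal ((t / r) ^ (q * γ)) * V) := by
                gcongr
                exact (Measure.restrict_apply_le _ _).trans (hgrow r t y ht.1 ht.2 hy)
            _ = C * V * (ENNReal.ofReal (t ^ (-δ - 1)) * ENNReal.ofReal ((t / r) ^ (q * γ))) := by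
                ring
            _ = _ := by
                rw [mul_assoc (C * V)]
                congr 1
                have ht0 := ht.1
                rw [← ENNReal.ofReal_mul (by positivity), ← ENNReal.ofReal_mul (by positivity)]
                congr 1
                rw [Real.div_rpow ht0.le hr.le, Real.rpow_neg hr.le,
                  show q * γ - δ - 1 = (-δ - 1) + q * γ by ring, Real.rpow_add ht0]
                ring
      _ = C * V * ENNReal.ofReal (r ^ (-(q * γ))) *
            ENNReal.ofReal ((q * γ - δ)⁻¹ * r ^ (q * γ - δ)) := by
          rw [lintegral_const_mul _ (by fun_prop), lintegral_Ioc_rpow hr hs]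
      _ = C * V * (ENNReal.ofReal (q * γ - δ)⁻¹ * ENNReal.ofReal (r ^ (-δ))) := by
          rw [mul_assoc (C * V)]
          congr 1
          rw [← ENNReal.ofReal_mul (by positivity), ← ENNReal.ofReal_mul (by positivity)]
          congr 1
          rw [show -δ = -(q * γ) + (q * γ - δ) by ring, Real.rpow_add hr]
          ring
      _ = _ := by ring
  have hlarge : ∫⁻ t in Ioi r, ENNReal.ofReal (t ^ (-δ - 1)) * μ (Metric.ball y t)
      ≤ ENNReal.ofReal δ⁻¹ * V * ENNReal.ofReal (r ^ (-δ)) := by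
    calc _ ≤ ∫⁻ t in Ioi r, ENNReal.ofReal (t ^ (-δ - 1)) * V := by
          refine lintegral_mono fun t => ?_
          gcongr
          exact (measure_mono (subset_univ _)).trans (by rw [hμ, Measure.restrict_apply_univ])
      _ = _ := by
          rw [lintegral_mul_const _ (by fun_prop), lintegral_Ioi_rpow hr hδ0]
          ring
  have hr' : ENNReal.ofReal (r ^ (-γ)) ^ p = ENNReal.ofReal (r ^ (-δ)) := by
    rw [ENNReal.ofReal_rpow_of_pos (by positivity), ← Real.rpow_mul hr.le, hδ, neg_mul]
  rw [hker, hr', ← Ioc_union_Ioi_eq_Ioi hr.le,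
    lintegral_union measurableSet_Ioi (Ioc_disjoint_Ioi le_rfl)]
  calc _ ≤ ENNReal.ofReal δ * (C * ENNReal.ofReal (q * γ - δ)⁻¹ * V * ENNReal.ofReal (r ^ (-δ)) +
        ENNReal.ofReal δ⁻¹ * V * ENNReal.ofReal (r ^ (-δ))) := by gcongr
    _ = _ := by ring

/-- The potential of the mass in `B(0, 2r)` has, in `L_p(B(0, r), v)`, the size of a constant
function with value `r ^ (-γ) μ(B(0, 2r))`: Hölder's inequality in `μ`, then Tonelli's theorem. -/
lemma exists_lintegral_measPotential_restrict_le {n : ℕ} {p γ : ℝ} (hp : 1 < p) {v : Rn n → ℝ}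
    (hker : ∃ C : ℝ≥0∞, C ≠ ∞ ∧ ∀ r : ℝ, ∀ y : Rn n, 0 < r → ‖y‖ < 2 * r →
      ∫⁻ x in Metric.ball 0 r, (ENNReal.ofReal (‖x - y‖ ^ γ))⁻¹ ^ p ∂(wMeasure v)
        ≤ C * wMeasure v (Metric.ball 0 r) * ENNReal.ofReal (r ^ (-γ)) ^ p) :
    ∃ C : ℝ≥0∞, C ≠ ∞ ∧ ∀ (μ : Measure (Rn n)) [SFinite μ] (r : ℝ), 0 < r →
      ∫⁻ x in Metric.ball 0 r,
          measPotential γ (μ.restrict (Metric.ball 0 (2 * r))) x ^ p ∂(wMeasure v)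
        ≤ C * wMeasure v (Metric.ball 0 r) *
            (ENNReal.ofReal (r ^ (-γ)) * μ (Metric.ball 0 (2 * r))) ^ p := by
  obtain ⟨C, hC, hker⟩ := hker
  refine ⟨C, hC, fun μ _ r hr => ?_⟩
  have hp0 : 0 < p := by linarith
  have : SFinite (wMeasure v) := by unfold wMeasure; infer_instance
  set B := Metric.ball (0 : Rn n) (2 * r)
  have hmeas : Measurable (Function.uncurry fun (x y : Rn n) =>
      (ENNReal.ofReal (‖x - y‖ ^ γ))⁻¹ ^ p) := by
    unfold Function.uncurry
    fun_prop
  calc ∫⁻ x in Metric.ball 0 r, measPotential γ (μ.restrict B) x ^ p ∂(wMeasure v)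
      ≤ ∫⁻ x in Metric.ball 0 r, μ B ^ (p - 1) *
          ∫⁻ y in B, (ENNReal.ofReal (‖x - y‖ ^ γ))⁻¹ ^ p ∂μ ∂(wMeasure v) := by
        refine lintegral_mono fun x => ?_
        have := lintegral_rpow_le_measure_univ_mul (μ.restrict B) hp
          (g := fun y => (ENNReal.ofReal (‖x - y‖ ^ γ))⁻¹) (by fun_prop)
        rwa [Measure.restrict_apply_univ] at this
    _ = μ B ^ (p - 1) * ∫⁻ y in B, ∫⁻ x in Metric.ball 0 r,
          (ENNReal.ofReal (‖x - y‖ ^ γ))⁻¹ ^ p ∂(wMeasure v) ∂μ := by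
        rw [lintegral_const_mul _ (hmeas.lintegral_prod_right), lintegral_lintegral_swap
          hmeas.aemeasurable]
    _ ≤ μ B ^ (p - 1) * ∫⁻ _ in B,
          C * wMeasure v (Metric.ball 0 r) * ENNReal.ofReal (r ^ (-γ)) ^ p ∂μ := by
        gcongr 1
        refine setLIntegral_mono' Metric.isOpen_ball.measurableSet fun y hy => ?_
        exact hker r y hr (mem_ball_zero_iff.1 hy)
    _ = C * wMeasure v (Metric.ball 0 r) * (ENNReal.ofReal (r ^ (-γ)) ^ p *
          (μ B ^ (p - 1) * μ B ^ (1 : ℝ))) := by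
        rw [setLIntegral_const, ENNReal.rpow_one]
        ring
    _ = _ := by
        rw [← ENNReal.rpow_add_of_nonneg _ _ (by linarith) zero_le_one, sub_add_cancel,
          ENNReal.mul_rpow_of_nonneg _ _ hp0.le]

/-! ### Norms on a single ball -/

lemma wLpNorm_eq {n : ℕ} {p : ℝ} {v : Rn n → ℝ} (hv : AEMeasurable v volume) (r : ℝ)
    (F : Rn n → ℝ≥0∞) : wLpNorm p v (Metric.ball 0 r) F
      = (∫⁻ x in Metric.ball 0 r, F x ^ p ∂(wMeasure v)) ^ (1 / p) := by
  rw [wLpNorm, wMeasure, setLIntegral_withDensity_eq_setLIntegral_mul_non_measurable₀ _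
    hv.ennreal_ofReal.restrict _ Metric.isOpen_ball.measurableSet
    (ae_of_all _ fun _ => ENNReal.ofReal_lt_top)]
  simp [mul_comm]

lemma le_wLpNorm {n : ℕ} {p : ℝ} (hp : 0 < p) {v : Rn n → ℝ} (hv : AEMeasurable v volume) {r : ℝ}
    {F : Rn n → ℝ≥0∞} {a : ℝ≥0∞} (h : ∀ x, ‖x‖ < r → a ≤ F x) :
    wMeasure v (Metric.ball 0 r) ^ (1 / p) * a ≤ wLpNorm p v (Metric.ball 0 r) F := by
  rw [wLpNorm_eq hv]
  calc wMeasure v (Metric.ball 0 r) ^ (1 / p) * a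
      = (∫⁻ _ in Metric.ball 0 r, a ^ p ∂(wMeasure v)) ^ (1 / p) := by
        rw [setLIntegral_const, ENNReal.mul_rpow_of_nonneg _ _ (by positivity), ← ENNReal.rpow_mul,
          mul_one_div_cancel hp.ne', ENNReal.rpow_one, mul_comm]
    _ ≤ _ := by
        refine ENNReal.rpow_le_rpow ?_ (by positivity)
        refine setLIntegral_mono' Metric.isOpen_ball.measurableSet fun x hx => ?_
        exact ENNReal.rpow_le_rpow (h x (mem_ball_zero_iff.1 hx)) hp.le

/-- No measurability of `F` or `L` is needed: only the constant part is split off. -/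
lemma wLpNorm_le {n : ℕ} {p : ℝ} (hp : 1 < p) {v : Rn n → ℝ} (hv : AEMeasurable v volume) {r : ℝ}
    {F L : Rn n → ℝ≥0∞} {b C D : ℝ≥0∞} (h : ∀ x, ‖x‖ < r → F x ≤ L x + b)
    (hL : ∫⁻ x in Metric.ball 0 r, L x ^ p ∂(wMeasure v)
      ≤ C * wMeasure v (Metric.ball 0 r) * D ^ p) :
    wLpNorm p v (Metric.ball 0 r) F
      ≤ (2 ^ (p - 1) * (C + 1)) ^ (1 / p) * (wMeasure v (Metric.ball 0 r) ^ (1 / p) * (D + b)) := by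
  have hp0 : 0 < p := by linarith
  set V := wMeasure v (Metric.ball (0 : Rn n) r)
  rw [wLpNorm_eq hv]
  have key : ∫⁻ x in Metric.ball 0 r, F x ^ p ∂(wMeasure v)
      ≤ 2 ^ (p - 1) * (C + 1) * (V * (D + b) ^ p) := by
    calc _ ≤ ∫⁻ x in Metric.ball 0 r, 2 ^ (p - 1) * (L x ^ p + b ^ p) ∂(wMeasure v) := by
          refine setLIntegral_mono' Metric.isOpen_ball.measurableSet fun x hx => ?_
          exact (ENNReal.rpow_le_rpow (h x (mem_ball_zero_iff.1 hx)) hp0.le).trans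
            (ENNReal.rpow_add_le_mul_rpow_add_rpow _ _ hp.le)
      _ = 2 ^ (p - 1) * (∫⁻ x in Metric.ball 0 r, L x ^ p ∂(wMeasure v) + b ^ p * V) := by
          rw [lintegral_const_mul' _ _ (ENNReal.rpow_ne_top_of_nonneg (by linarith) (by simp)),
            lintegral_add_right _ measurable_const, setLIntegral_const]
      _ ≤ 2 ^ (p - 1) * (C * V * (D + b) ^ p + (D + b) ^ p * V) := by
          gcongr
          · exact hL.trans (by gcongr; exact le_self_add)
          · exact le_add_self
      _ = _ := by ring
  refine (ENNReal.rpow_le_rpow key (by positivity)).trans (le_of_eq ?_)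
  rw [ENNReal.mul_rpow_of_nonneg _ _ (by positivity), ENNReal.mul_rpow_of_nonneg V _ (by positivity),
    ← ENNReal.rpow_mul, mul_one_div_cancel hp0.ne', ENNReal.rpow_one]

/-! ### Reduction of the Morrey quasinorms to truncated operators at the origin -/

section Morrey

variable {n : ℕ} {p q α : ℝ} {ω : ℝ → ℝ} {v f : Rn n → ℝ}

lemma wLpNorm_le_centralMorreyNorm (p : ℝ) (ω : ℝ → ℝ) (v : Rn n → ℝ) (F : Rn n → ℝ≥0∞) {r : ℝ}
    (hr : 0 < r) :
    ENNReal.ofReal (ω r) * wLpNorm p v (Metric.ball 0 r) F ≤ centralMorreyNorm p ω v F :=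
  le_iSup₂ (f := fun (r : ℝ) (_ : 0 < r) =>
    ENNReal.ofReal (ω r) * wLpNorm p v (Metric.ball 0 r) F) r hr

lemma uFun_mul_le_centralMorreyNorm (hp : 0 < p) (hv : AEMeasurable v volume) {r : ℝ} (hr : 0 < r)
    {F : Rn n → ℝ≥0∞} {a c : ℝ≥0∞} (hc : c ≠ ∞) (h : ∀ x, ‖x‖ < r → a ≤ c * F x) :
    uFun p ω v r * a ≤ c * centralMorreyNorm p ω v F := by
  rcases eq_or_ne c 0 with rfl | hc0
  · have : a = 0 := by simpa using h 0 (by simpa using hr)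
    simp [this]
  have h' : ∀ x, ‖x‖ < r → c⁻¹ * a ≤ F x := fun x hx => by
    rw [mul_comm, ← div_eq_mul_inv]
    exact ENNReal.div_le_of_le_mul' (h x hx)
  calc uFun p ω v r * a
      = c * (ENNReal.ofReal (ω r) *
          (wMeasure v (Metric.ball 0 r) ^ (1 / p) * (c⁻¹ * a))) := by
        rw [uFun]
        calc _ = (c * c⁻¹) *
              (ENNReal.ofReal (ω r) * wMeasure v (Metric.ball 0 r) ^ (1 / p) * a) := by
              rw [ENNReal.mul_inv_cancel hc0 hc, one_mul]
          _ = _ := by ring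
    _ ≤ c * (ENNReal.ofReal (ω r) * wLpNorm p v (Metric.ball 0 r) F) := by
        gcongr
        exact le_wLpNorm hp hv h'
    _ ≤ _ := by
        gcongr
        exact wLpNorm_le_centralMorreyNorm p ω v F hr

lemma uFun_mul_truncPotential_le (hp : 0 < p) (hαn : α < n) (hv : AEMeasurable v volume)
    (hf : AEMeasurable f volume) {r : ℝ} (hr : 0 < r) :
    uFun p ω v r * truncPotential ((n : ℝ) - α) (wMeasure f) r
      ≤ ENNReal.ofReal (2 ^ ((n : ℝ) - α)) * centralMorreyNorm p ω v (rieszPotential α f) := by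
  refine uFun_mul_le_centralMorreyNorm hp hv hr ENNReal.ofReal_ne_top fun x hx => ?_
  rw [rieszPotential_eq_measPotential α hf]
  exact truncPotential_le_measPotential _ (by linarith) hx

lemma uFun_mul_truncMaximal_le (hp : 0 < p) (hn : n ≠ 0) (hv : AEMeasurable v volume)
    {r : ℝ} (hr : 0 < r) :
    uFun p ω v r * truncMaximal ((n : ℝ) - α) (wMeasure f) r
      ≤ ENNReal.ofReal (2 ^ ((n : ℝ) - α)) * volume (Metric.ball (0 : Rn n) 1) ^ (1 - α / (n : ℝ))
        * centralMorreyNorm p ω v (fracMaximal α f) := by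
  refine uFun_mul_le_centralMorreyNorm hp hv hr
    (ENNReal.mul_ne_top ENNReal.ofReal_ne_top (volume_unitBall_rpow_ne_top n _)) fun x hx => ?_
  rw [fracMaximal_eq_measMaximal hn, mul_assoc, ← mul_assoc (_ ^ _), ENNReal.mul_inv_cancel
    (volume_unitBall_rpow_ne_zero n _) (volume_unitBall_rpow_ne_top n _), one_mul]
  exact truncMaximal_le_measMaximal _ hx

/-- A pointwise bound by the local potential plus a constant, when both parts are controlled by
`T r`, reduces the Morrey quasinorm to `sup_{r > 0} u(r) T(r)`. -/
lemma centralMorreyNorm_le (hp : 1 < p) (hv : AEMeasurable v volume) {γ : ℝ}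
    {μ : Measure (Rn n)} {A C₀ C₁ : ℝ≥0∞} (hA : A ≠ ∞)
    (hloc : ∀ r : ℝ, 0 < r → ∫⁻ x in Metric.ball 0 r,
          measPotential γ (μ.restrict (Metric.ball 0 (2 * r))) x ^ p ∂(wMeasure v)
        ≤ C₀ * wMeasure v (Metric.ball 0 r) *
            (ENNReal.ofReal (r ^ (-γ)) * μ (Metric.ball 0 (2 * r))) ^ p)
    {F : Rn n → ℝ≥0∞} {T : ℝ → ℝ≥0∞}
    (hF : ∀ r x, ‖x‖ < r → F x ≤ A * (measPotential γ (μ.restrict (Metric.ball 0 (2 * r))) x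
      + C₁ * T r))
    (hT : ∀ r, 0 < r → ENNReal.ofReal (r ^ (-γ)) * μ (Metric.ball 0 (2 * r)) ≤ C₁ * T r)
    {K : ℝ≥0∞} (hK : ∀ r, 0 < r → uFun p ω v r * T r ≤ K) :
    centralMorreyNorm p ω v F ≤ A * (2 ^ (p - 1) * (C₀ + 1)) ^ (1 / p) * (2 * C₁) * K := by
  have hp0 : 0 < p := by linarith
  refine iSup₂_le fun r hr => ?_
  set V := wMeasure v (Metric.ball (0 : Rn n) r)
  set P := measPotential γ (μ.restrict (Metric.ball 0 (2 * r)))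
  set D := ENNReal.ofReal (r ^ (-γ)) * μ (Metric.ball 0 (2 * r))
  have hL : ∫⁻ x in Metric.ball 0 r, (A * P x) ^ p ∂(wMeasure v) ≤ C₀ * V * (A * D) ^ p := by
    simp only [ENNReal.mul_rpow_of_nonneg _ _ hp0.le]
    rw [lintegral_const_mul' _ _ (ENNReal.rpow_ne_top_of_nonneg hp0.le hA)]
    calc _ ≤ A ^ p * (C₀ * V * D ^ p) := by gcongr; exact hloc r hr
      _ = _ := by ring
  calc ENNReal.ofReal (ω r) * wLpNorm p v (Metric.ball 0 r) F
      ≤ ENNReal.ofReal (ω r) * ((2 ^ (p - 1) * (C₀ + 1)) ^ (1 / p) *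
          (V ^ (1 / p) * (A * D + A * (C₁ * T r)))) := by
        gcongr
        exact wLpNorm_le hp hv (fun x hx => (hF r x hx).trans (le_of_eq (mul_add _ _ _))) hL
    _ ≤ ENNReal.ofReal (ω r) * ((2 ^ (p - 1) * (C₀ + 1)) ^ (1 / p) *
          (V ^ (1 / p) * (A * (C₁ * T r) + A * (C₁ * T r)))) := by
        gcongr
        exact hT r hr
    _ = A * (2 ^ (p - 1) * (C₀ + 1)) ^ (1 / p) * (2 * C₁) * (uFun p ω v r * T r) := by
        rw [uFun]; ring
    _ ≤ _ := by gcongr; exact hK r hr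

end Morrey

/-! ### The function `U` -/

section UFun

variable {n : ℕ} {p α : ℝ} {ω : ℝ → ℝ} {v : Rn n → ℝ}

lemma le_UFun {s t τ : ℝ} (hs : 0 < s) (hsτ : s < τ) (htτ : t < τ) :
    ENNReal.ofReal (τ ^ (-((n : ℝ) - α))) * uFun p ω v s ≤ UFun p α ω v t := by
  rw [neg_sub]
  refine le_trans ?_ (le_iSup₂ (f := fun (t' : ℝ) (_ : t < t') =>
    ENNReal.ofReal (t' ^ (α - (n : ℝ))) * ⨆ (s : ℝ) (_ : 0 < s ∧ s < t'), uFun p ω v s) τ htτ)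
  gcongr
  exact le_iSup₂ (f := fun (s : ℝ) (_ : 0 < s ∧ s < τ) => uFun p ω v s) s ⟨hs, hsτ⟩

lemma UFun_mul_le {t : ℝ} {a K : ℝ≥0∞} (h : ∀ s τ, 0 < s → s < τ → t < τ →
      ENNReal.ofReal (τ ^ (-((n : ℝ) - α))) * uFun p ω v s * a ≤ K) :
    UFun p α ω v t * a ≤ K := by
  simp only [UFun, ENNReal.iSup_mul, ENNReal.mul_iSup]
  refine iSup₂_le fun τ hτ => iSup₂_le fun s hs => ?_
  rw [← neg_sub (n : ℝ) α]
  exact h s τ hs.1 hs.2 hτ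

lemma UFun_antitone : Antitone (UFun p α ω v) := fun _ _ h =>
  iSup_mono fun _ => iSup_mono' fun ht => ⟨h.trans_lt ht, le_rfl⟩

/-- The bound `le_UFun` extends to `τ = t` by continuity of the power. -/
lemma le_UFun_self {s t : ℝ} (hs : 0 < s) (hst : s ≤ t) :
    ENNReal.ofReal (t ^ (-((n : ℝ) - α))) * uFun p ω v s ≤ UFun p α ω v t := by
  have ht : 0 < t := hs.trans_le hst
  have hc : Filter.Tendsto (fun τ : ℝ => ENNReal.ofReal (τ ^ (-((n : ℝ) - α))) * uFun p ω v s)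
      (nhdsWithin t (Ioi t)) (nhds (ENNReal.ofReal (t ^ (-((n : ℝ) - α))) * uFun p ω v s)) := by
    refine ENNReal.Tendsto.mul_const ?_ (Or.inl (by simp; positivity))
    refine ENNReal.tendsto_ofReal (Filter.Tendsto.mono_left ?_ nhdsWithin_le_nhds)
    exact (Real.continuousAt_rpow_const _ _ (Or.inl ht.ne'))
  refine le_of_tendsto hc ?_
  filter_upwards [self_mem_nhdsWithin] with τ hτ
  exact le_UFun hs (hst.trans_lt hτ) hτ

lemma UFun_pos (hω : IsContWeight ω) (hv : IsWeight v) {t : ℝ} (ht : 0 < t) :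
    0 < UFun p α ω v t := by
  refine lt_of_lt_of_le ?_ (le_UFun_self ht le_rfl)
  refine ENNReal.mul_pos (by simp; positivity) (mul_ne_zero ?_ ?_)
  · simpa using hω.2 t ht
  · exact (ENNReal.rpow_pos (wMeasure_ball_pos hv 0 ht) (wMeasure_ball_lt_top hv 0 t).ne).ne'

/-- The values of `U` are all finite or all infinite; this is the direction used below. -/
lemma UFun_eq_top_of_lt (hαn : α < n) {r t : ℝ} (hr : 0 < r) (hrt : r < t)
    (h : UFun p α ω v r = ∞) : UFun p α ω v t = ∞ := by
  by_contra hne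
  have ht : 0 < t := hr.trans hrt
  have hγ : (0 : ℝ) < n - α := by linarith
  have hpos : ENNReal.ofReal ((t + 1) ^ (-((n : ℝ) - α))) ≠ 0 := by simp; positivity
  -- a common bound for `u` on `(0, t]`
  set b := UFun p α ω v t / ENNReal.ofReal ((t + 1) ^ (-((n : ℝ) - α)))
  have hb : b ≠ ∞ := ENNReal.div_ne_top hne hpos
  have hub : ∀ s, 0 < s → s ≤ t → uFun p ω v s ≤ b := fun s hs hst => by
    rw [ENNReal.le_div_iff_mul_le (Or.inl hpos) (Or.inl ENNReal.ofReal_ne_top), mul_comm]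
    exact le_UFun hs (by linarith) (by linarith)
  have hU : UFun p α ω v r * 1 ≤ ENNReal.ofReal (r ^ (-((n : ℝ) - α))) * b + UFun p α ω v t := by
    refine UFun_mul_le fun s τ hs hsτ hrτ => ?_
    rw [mul_one]
    rcases le_or_gt τ t with hτt | hτt
    · exact le_add_right (mul_le_mul' (ofReal_rpow_neg_le hr hrτ.le hγ)
        (hub s hs (hsτ.le.trans hτt)))
    · exact le_add_left (le_UFun hs hsτ hτt)
  rw [mul_one, h, top_le_iff, ENNReal.add_eq_top] at hU
  exact hU.elim (ENNReal.mul_ne_top ENNReal.ofReal_ne_top hb) hne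

end UFun

/-! ### Test functions with prescribed mass in balls -/

lemma volume_annulus {n : ℕ} {t : ℝ} (ht : 0 < t) :
    volume (Metric.ball (0 : Rn n) (2 * t) \ Metric.ball 0 t)
      = ENNReal.ofReal (t ^ (n : ℝ)) *
        (ENNReal.ofReal (2 ^ n - 1) * volume (Metric.ball (0 : Rn n) 1)) := by
  have h1 : (1 : ℝ) ≤ 2 ^ n := one_le_pow₀ (by norm_num)
  rw [measure_sdiff (Metric.ball_subset_ball (by linarith))
    Metric.isOpen_ball.measurableSet.nullMeasurableSet measure_ball_lt_top.ne,
    Measure.addHaar_ball_of_pos volume 0 (by positivity : 0 < 2 * t),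
    Measure.addHaar_ball_of_pos volume 0 ht, finrank_euclideanSpace_fin, Real.rpow_natCast,
    ← ENNReal.sub_mul (fun _ _ => measure_ball_lt_top.ne), ← mul_assoc, ← ENNReal.ofReal_mul
    (by positivity), ← ENNReal.ofReal_sub _ (by positivity)]
  congr 2
  rw [mul_pow]; ring

lemma setLIntegral_ball_two_mul {n : ℕ} (φ : Rn n → ℝ≥0∞) (hφ : Measurable φ) (t : ℝ) :
    ∫⁻ x in Metric.ball 0 t, φ ((2 : ℝ) • x)
      = ENNReal.ofReal ((2 ^ n)⁻¹) * ∫⁻ x in Metric.ball 0 (2 * t), φ x := by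
  have hm := Measure.map_addHaar_smul (volume : Measure (Rn n)) (two_ne_zero (α := ℝ))
  rw [finrank_euclideanSpace_fin, abs_of_pos (by positivity)] at hm
  have hb : MeasurableSet (Metric.ball (0 : Rn n) (2 * t)) := Metric.isOpen_ball.measurableSet
  rw [← lintegral_indicator hb, ← smul_eq_mul, ← lintegral_smul_measure, ← hm,
    lintegral_map (hφ.indicator hb) (by fun_prop),
    ← lintegral_indicator Metric.isOpen_ball.measurableSet]
  refine lintegral_congr fun x => ?_
  simp [indicator, norm_smul]

/-- Every nonnegative nondecreasing `h` vanishing near `0` is, up to constants and a dilation, the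
mass of balls for some density: the density `|x| ^ (-n) (h (2 |x|) - h |x|)` has mass
`∫_{t ≤ |x| < 2t} |x| ^ (-n) h |x| dx` in `B(0, t)`, because `|x| ^ (-n) dx` is invariant under
dilations. -/
lemma exists_measure_ball_comparable {n : ℕ} (hn : n ≠ 0) :
    ∃ c C : ℝ≥0∞, c ≠ 0 ∧ C ≠ ∞ ∧ ∀ (r : ℝ) (h : ℝ → ℝ), 0 < r → Monotone h → (∀ t, 0 ≤ h t) →
      (∀ t, t ≤ r → h t = 0) → ∃ f : Rn n → ℝ, LocallyIntegrable f volume ∧ (∀ x, 0 ≤ f x) ∧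
        ∀ t, 0 < t → c * ENNReal.ofReal (h t) ≤ wMeasure f (Metric.ball 0 t) ∧
          wMeasure f (Metric.ball 0 t) ≤ C * ENNReal.ofReal (h (2 * t)) := by
  set m := ENNReal.ofReal (2 ^ n - 1) * volume (Metric.ball (0 : Rn n) 1) with hm
  have h2n : (1 : ℝ) < 2 ^ n := one_lt_pow₀ (by norm_num) hn
  have hm0 : m ≠ 0 := mul_ne_zero (by simpa using h2n) (Metric.measure_ball_pos _ _ one_pos).ne'
  have hm1 : m ≠ ∞ := ENNReal.mul_ne_top ENNReal.ofReal_ne_top measure_ball_lt_top.ne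
  clear_value m
  refine ⟨ENNReal.ofReal (2 ^ (-(n : ℝ))) * m, m, mul_ne_zero (by simp) hm0, hm1, ?_⟩
  intro r h hr hmono hnn hzero
  have hmeas : Measurable h := hmono.measurable
  set f : Rn n → ℝ := fun x => ‖x‖ ^ (-(n : ℝ)) * (h (2 * ‖x‖) - h ‖x‖) with hf
  have hfnn : ∀ x, 0 ≤ f x := fun x => by
    have := hmono (by linarith [norm_nonneg x] : ‖x‖ ≤ 2 * ‖x‖)
    have h2 := Real.rpow_nonneg (norm_nonneg x) (-(n : ℝ))
    exact mul_nonneg h2 (by linarith)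
  have hfmeas : Measurable f := by
    rw [hf]
    exact (by fun_prop : Measurable fun x : Rn n => ‖x‖ ^ (-(n : ℝ))).mul
      ((hmeas.comp (by fun_prop)).sub (hmeas.comp (by fun_prop)))
  have hn' : (0 : ℝ) ≤ n := by positivity
  have hpow : ∀ {a b : ℝ}, 0 < a → a ≤ b → b ^ (-(n : ℝ)) ≤ a ^ (-(n : ℝ)) := fun ha hab =>
    Real.rpow_le_rpow_of_nonpos ha hab (by linarith)
  have hfb : ∀ R : ℝ, ∀ x : Rn n, ‖x‖ ≤ R → f x ≤ (r / 2) ^ (-(n : ℝ)) * h (2 * R) := by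
    intro R x hx
    rcases le_or_gt (2 * ‖x‖) r with h2 | h2
    · have : f x = 0 := by
        simp [hf, hzero _ h2, hzero ‖x‖ (by linarith [norm_nonneg x])]
      rw [this]
      exact mul_nonneg (by positivity) (hnn _)
    · have : h (2 * ‖x‖) - h ‖x‖ ≤ h (2 * R) := by
        have := hmono (by linarith : 2 * ‖x‖ ≤ 2 * R)
        linarith [hnn ‖x‖]
      have h0 := hpow (by positivity : 0 < r / 2) (by linarith : r / 2 ≤ ‖x‖)
      have h3 : 0 ≤ (r / 2) ^ (-(n : ℝ)) := by positivity
      have h4 : 0 ≤ h (2 * ‖x‖) - h ‖x‖ :=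
        sub_nonneg.2 (hmono (by linarith [norm_nonneg x]))
      exact mul_le_mul h0 this h4 h3
  refine ⟨f, ?_, hfnn, fun t ht => ?_⟩
  · rw [locallyIntegrable_iff]
    intro k hk
    obtain ⟨R, hR⟩ := hk.isBounded.subset_closedBall 0
    refine IntegrableOn.mono_set ?_ hR
    refine IntegrableOn.of_bound measure_closedBall_lt_top hfmeas.aestronglyMeasurable
      ((r / 2) ^ (-(n : ℝ)) * h (2 * R)) ?_
    filter_upwards [ae_restrict_mem Metric.isClosed_closedBall.measurableSet] with x hx
    rw [Real.norm_of_nonneg (hfnn x)]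
    exact hfb R x (by simpa using hx)
  · set φ : Rn n → ℝ≥0∞ := fun x => ENNReal.ofReal (‖x‖ ^ (-(n : ℝ)) * h ‖x‖) with hφ
    have hφmeas : Measurable φ :=
      ((by fun_prop : Measurable fun x : Rn n => ‖x‖ ^ (-(n : ℝ))).mul
        (hmeas.comp (by fun_prop))).ennreal_ofReal
    have hφtop : ∫⁻ x in Metric.ball 0 t, φ x ≠ ∞ := by
      refine ne_top_of_le_ne_top (ENNReal.mul_ne_top
        (ENNReal.ofReal_ne_top (r := r ^ (-(n : ℝ)) * h t))
        (measure_ball_lt_top (μ := volume) (x := (0 : Rn n)) (r := t)).ne) ?_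
      rw [← setLIntegral_const]
      refine setLIntegral_mono' Metric.isOpen_ball.measurableSet fun x hx => ?_
      have hxt := (mem_ball_zero_iff.1 hx).le
      refine ENNReal.ofReal_le_ofReal ?_
      rcases le_or_gt ‖x‖ r with h2 | h2
      · rw [hzero _ h2, mul_zero]
        exact mul_nonneg (by positivity) (hnn _)
      · exact mul_le_mul (hpow hr h2.le) (hmono hxt) (hnn _) (by positivity)
    have hmass : wMeasure f (Metric.ball 0 t)
        = ∫⁻ x in Metric.ball 0 (2 * t) \ Metric.ball 0 t, φ x := by
      have e1 : ∫⁻ x in Metric.ball (0 : Rn n) t, (ENNReal.ofReal (f x) + φ x)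
          = ∫⁻ x in Metric.ball 0 (2 * t), φ x := by
        have e2 : ∀ x, ENNReal.ofReal (f x) + φ x = ENNReal.ofReal (2 ^ n) * φ ((2 : ℝ) • x) := by
          intro x
          have h2 := Real.rpow_nonneg (norm_nonneg x) (-(n : ℝ))
          rw [hφ, ← ENNReal.ofReal_add (hfnn x) (mul_nonneg h2 (hnn _)),
            ← ENNReal.ofReal_mul (by positivity)]
          congr 1
          rw [norm_smul, Real.norm_of_nonneg zero_le_two, Real.mul_rpow zero_le_two (norm_nonneg x),
            Real.rpow_neg zero_le_two, Real.rpow_natCast, hf]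
          field_simp
          ring
        simp_rw [e2]
        rw [lintegral_const_mul' _ _ ENNReal.ofReal_ne_top, setLIntegral_ball_two_mul φ hφmeas,
          ← mul_assoc, ← ENNReal.ofReal_mul (by positivity), mul_inv_cancel₀ (by positivity),
          ENNReal.ofReal_one, one_mul]
      rw [lintegral_add_right _ hφmeas, ← lintegral_inter_add_sdiff φ (Metric.ball 0 (2 * t))
        Metric.isOpen_ball.measurableSet (B := Metric.ball (0 : Rn n) t), inter_eq_right.2
        (Metric.ball_subset_ball (by linarith)), add_comm] at e1
      rw [wMeasure_apply f Metric.isOpen_ball.measurableSet]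
      exact (ENNReal.add_right_inj hφtop).1 e1
    have hann : MeasurableSet (Metric.ball (0 : Rn n) (2 * t) \ Metric.ball 0 t) :=
      Metric.isOpen_ball.measurableSet.diff Metric.isOpen_ball.measurableSet
    have hmem : ∀ x ∈ Metric.ball (0 : Rn n) (2 * t) \ Metric.ball 0 t,
        t ≤ ‖x‖ ∧ ‖x‖ ≤ 2 * t := fun x hx =>
      ⟨by simpa using hx.2, (mem_ball_zero_iff.1 hx.1).le⟩
    rw [hmass]
    constructor
    · calc ENNReal.ofReal (2 ^ (-(n : ℝ))) * m * ENNReal.ofReal (h t)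
          = ENNReal.ofReal ((2 * t) ^ (-(n : ℝ)) * h t) *
              volume (Metric.ball (0 : Rn n) (2 * t) \ Metric.ball 0 t) := by
            have e : (2 * t) ^ (-(n : ℝ)) * h t * t ^ (n : ℝ) = 2 ^ (-(n : ℝ)) * h t := by
              rw [Real.mul_rpow zero_le_two ht.le, Real.rpow_neg ht.le]
              field_simp
            rw [volume_annulus ht, ← hm, ← mul_assoc (ENNReal.ofReal (_ * _)), ← ENNReal.ofReal_mul
              (mul_nonneg (by positivity) (hnn t)), e, ENNReal.ofReal_mul (by positivity)]
            ring
        _ ≤ _ := by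
            rw [← setLIntegral_const]
            refine setLIntegral_mono' hann fun x hx => ENNReal.ofReal_le_ofReal ?_
            obtain ⟨h1, h2⟩ := hmem x hx
            exact mul_le_mul (hpow (by linarith) h2) (hmono h1) (hnn _)
              (Real.rpow_nonneg (norm_nonneg x) _)
    · calc _ ≤ ∫⁻ _ in Metric.ball (0 : Rn n) (2 * t) \ Metric.ball 0 t,
            ENNReal.ofReal (t ^ (-(n : ℝ)) * h (2 * t)) := by
            refine setLIntegral_mono' hann fun x hx => ENNReal.ofReal_le_ofReal ?_
            obtain ⟨h1, h2⟩ := hmem x hx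
            exact mul_le_mul (hpow ht h1) (hmono h2) (hnn _) (by positivity)
        _ = _ := by
            rw [setLIntegral_const, volume_annulus ht, ← hm, ← mul_assoc, ← ENNReal.ofReal_mul
              (mul_nonneg (by positivity) (hnn _)), mul_comm m, Real.rpow_neg ht.le]
            congr 2
            field_simp

/-! ### The norm inequalities and the condition on `U` -/

section Main

variable {n : ℕ} {p q α : ℝ} {ω : ℝ → ℝ} {v : Rn n → ℝ}

/-- The pointwise bound `M_α f ≤ c I_α f` gives one of the two norm inequalities for free. -/
lemma centralMorreyNorm_fracMaximal_le (hp : 0 < p) (hn : n ≠ 0) (hαn : α < n) {f : Rn n → ℝ}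
    (hf : AEMeasurable f volume) :
    centralMorreyNorm p ω v (fracMaximal α f)
      ≤ (volume (Metric.ball (0 : Rn n) 1) ^ (1 - α / (n : ℝ)))⁻¹
        * centralMorreyNorm p ω v (rieszPotential α f) := by
  set W := (volume (Metric.ball (0 : Rn n) 1) ^ (1 - α / (n : ℝ)))⁻¹
  have hW : W ≠ ∞ := ENNReal.inv_ne_top.2 (volume_unitBall_rpow_ne_zero n _)
  refine iSup₂_le fun r hr => ?_
  have h1 : wLpNorm p v (Metric.ball 0 r) (fracMaximal α f)
      ≤ W * wLpNorm p v (Metric.ball 0 r) (rieszPotential α f) := by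
    have hWp : W = (W ^ p) ^ (1 / p) := by
      rw [← ENNReal.rpow_mul, mul_one_div_cancel hp.ne', ENNReal.rpow_one]
    rw [wLpNorm, wLpNorm, hWp, ← ENNReal.mul_rpow_of_nonneg _ _ (by positivity),
      ← lintegral_const_mul' _ _ (ENNReal.rpow_ne_top_of_nonneg hp.le hW)]
    refine ENNReal.rpow_le_rpow (lintegral_mono fun x => ?_) (by positivity)
    dsimp only
    rw [← mul_assoc, ← ENNReal.mul_rpow_of_nonneg _ _ hp.le]
    gcongr
    rw [fracMaximal_eq_measMaximal hn, rieszPotential_eq_measPotential α hf]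
    gcongr
    exact measMaximal_le_measPotential _ (by linarith) x
  calc _ ≤ ENNReal.ofReal (ω r) * (W * wLpNorm p v (Metric.ball 0 r) (rieszPotential α f)) := by
        gcongr
    _ = W * (ENNReal.ofReal (ω r) * wLpNorm p v (Metric.ball 0 r) (rieszPotential α f)) := by ring
    _ ≤ _ := by
        gcongr
        exact wLpNorm_le_centralMorreyNorm p ω v _ hr

/-- Upper bounds for both quasinorms by the truncated operators at the origin, with one constant. -/
lemma exists_centralMorreyNorm_le (hp : 1 < p) (hpq : p < q) (hn : n ≠ 0) (hαn : α < n)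
    (hvA : MuckenhouptAinfty v) (hvRD : ReverseDoubling (q * (1 - α / (n : ℝ))) v) :
    ∃ C : ℝ≥0∞, C ≠ ∞ ∧ ∀ (ω : ℝ → ℝ) (f : Rn n → ℝ), AEMeasurable f volume → ∀ K : ℝ≥0∞,
      ((∀ r, 0 < r → uFun p ω v r * truncPotential ((n : ℝ) - α) (wMeasure f) r ≤ K) →
        centralMorreyNorm p ω v (rieszPotential α f) ≤ C * K) ∧
      ((∀ r, 0 < r → uFun p ω v r * truncMaximal ((n : ℝ) - α) (wMeasure f) r ≤ K) →
        centralMorreyNorm p ω v (fracMaximal α f) ≤ C * K) := by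
  have hγ : (0 : ℝ) < n - α := by linarith
  have hvm : AEMeasurable v volume := hvA.1.1.aestronglyMeasurable.aemeasurable
  obtain ⟨C₀, hC₀, hloc⟩ := exists_lintegral_measPotential_restrict_le hp
    (exists_lintegral_kernel_rpow_le hn (by linarith) hpq hγ (exists_measure_ball_le hn hvA hvRD))
  set W := (volume (Metric.ball (0 : Rn n) 1) ^ (1 - α / (n : ℝ)))⁻¹
  have hW : W ≠ ∞ := ENNReal.inv_ne_top.2 (volume_unitBall_rpow_ne_zero n _)
  set κ : ℝ≥0∞ := (2 ^ (p - 1) * (C₀ + 1)) ^ (1 / p)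
  have hκ : κ ≠ ∞ := ENNReal.rpow_ne_top_of_nonneg (by positivity) (ENNReal.mul_ne_top
    (ENNReal.rpow_ne_top_of_nonneg (by linarith) (by simp)) (by simp [hC₀]))
  set C₁ := ENNReal.ofReal (2 ^ ((n : ℝ) - α))
  have hC₁ : 2 * C₁ ≠ ∞ := ENNReal.mul_ne_top (by simp) ENNReal.ofReal_ne_top
  refine ⟨(1 + W) * κ * (2 * C₁), ENNReal.mul_ne_top (ENNReal.mul_ne_top (by simp [hW]) hκ) hC₁,
    fun ω f hf K => ?_⟩
  have : SFinite (wMeasure f) := by unfold wMeasure; infer_instance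
  refine ⟨fun hK => ?_, fun hK => ?_⟩
  · refine (centralMorreyNorm_le hp hvm ENNReal.one_ne_top (hloc (wMeasure f))
      (C₁ := C₁) (T := truncPotential ((n : ℝ) - α) (wMeasure f)) (fun r x hx => ?_)
      (fun r hr => measure_ball_two_mul_le_truncPotential _ hγ hr) hK).trans ?_
    · rw [one_mul, rieszPotential_eq_measPotential α hf]
      exact measPotential_le_add _ hγ hx
    · gcongr
      exact le_self_add
  · refine (centralMorreyNorm_le hp hvm hW (hloc (wMeasure f))
      (C₁ := C₁) (T := truncMaximal ((n : ℝ) - α) (wMeasure f)) (fun r x hx => ?_)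
      (fun r hr => measure_ball_two_mul_le_truncMaximal _ hr) hK).trans ?_
    · rw [fracMaximal_eq_measMaximal hn]
      gcongr
      exact measMaximal_le_add _ hγ hx
    · gcongr
      exact le_add_self

/-- The quantity `r ^ (n - α) U(r) ∫_r^∞ t ^ (α - n - 1) U(t)⁻¹ dt` whose supremum characterizes
the norm equivalence, with the exponents written through `n - α`. -/
noncomputable def hardyQuantity (p α : ℝ) (ω : ℝ → ℝ) (v : Rn n → ℝ) (r : ℝ) : ℝ≥0∞ :=
  ENNReal.ofReal (r ^ ((n : ℝ) - α)) * UFun p α ω v r *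
    ∫⁻ t in Ioi r, ENNReal.ofReal (t ^ (-((n : ℝ) - α) - 1)) * (UFun p α ω v t)⁻¹

lemma ofReal_rpow_mul_neg {r : ℝ} (γ : ℝ) (hr : 0 < r) :
    ENNReal.ofReal (r ^ γ) * ENNReal.ofReal (r ^ (-γ)) = 1 := by
  rw [← ENNReal.ofReal_mul (by positivity), ← Real.rpow_add hr, add_neg_cancel, Real.rpow_zero,
    ENNReal.ofReal_one]

/-- If `A` bounds all `u(r) sup_{t > r} t ^ (α - n) μ(B(0, t))`, then `μ(B(0, t)) ≤ A / U(t)`, and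
integrating this against `t ^ (α - n - 1)` bounds the truncated potential. -/
lemma uFun_mul_truncPotential_le_of_hardyQuantity_le (hαn : α < n) (hω : IsContWeight ω)
    (hv : IsWeight v) {K A : ℝ≥0∞} (hA : A ≠ ∞) (hK : ∀ r, 0 < r → hardyQuantity p α ω v r ≤ K)
    (μ : Measure (Rn n)) [SFinite μ]
    (hμ : ∀ r, 0 < r → uFun p ω v r * truncMaximal ((n : ℝ) - α) μ r ≤ A) {r : ℝ} (hr : 0 < r) :
    uFun p ω v r * truncPotential ((n : ℝ) - α) μ r ≤ ENNReal.ofReal ((n : ℝ) - α) * A * K := by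
  have hγ : (0 : ℝ) < n - α := by linarith
  set γ := (n : ℝ) - α with hγdef
  have hball : ∀ t, 0 < t → μ (Metric.ball 0 t) ≤ A * (UFun p α ω v t)⁻¹ := fun t ht => by
    rw [← div_eq_mul_inv, ENNReal.le_div_iff_mul_le (Or.inl (UFun_pos hω hv ht).ne')
      (Or.inr hA), mul_comm]
    refine UFun_mul_le fun s τ hs hsτ htτ => ?_
    refine le_trans ?_ (hμ s hs)
    rw [mul_comm (ENNReal.ofReal _), mul_assoc]
    refine mul_le_mul_right (le_trans ?_ (le_iSup₂ (f := fun (t : ℝ) (_ : s < t) =>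
      ENNReal.ofReal (t ^ (-γ)) * μ (Metric.ball 0 t)) τ hsτ)) _
    gcongr
  have hu : uFun p ω v r ≤ ENNReal.ofReal (r ^ γ) * UFun p α ω v r := by
    calc uFun p ω v r = ENNReal.ofReal (r ^ γ) * (ENNReal.ofReal (r ^ (-γ)) * uFun p ω v r) := by
          rw [← mul_assoc, ofReal_rpow_mul_neg γ hr, one_mul]
      _ ≤ _ := by
          gcongr
          exact le_UFun_self hr le_rfl
  have htrunc : truncPotential γ μ r = ENNReal.ofReal γ *
      ∫⁻ t in Ioi r, ENNReal.ofReal (t ^ (-γ - 1)) * μ (Metric.ball 0 t) := by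
    rw [lintegral_Ioi_eq_truncPotential μ hγ hr, ← mul_assoc, ← ENNReal.ofReal_mul hγ.le,
      mul_inv_cancel₀ hγ.ne', ENNReal.ofReal_one, one_mul]
  rw [htrunc]
  calc _ ≤ uFun p ω v r * (ENNReal.ofReal γ * ∫⁻ t in Ioi r,
        A * (ENNReal.ofReal (t ^ (-γ - 1)) * (UFun p α ω v t)⁻¹)) := by
        refine mul_le_mul_right (mul_le_mul_right (setLIntegral_mono' measurableSet_Ioi
          fun t ht => ?_) _) _
        rw [mul_left_comm]
        exact mul_le_mul_right (hball t (hr.trans ht)) _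
    _ = ENNReal.ofReal γ * A * (uFun p ω v r *
        ∫⁻ t in Ioi r, ENNReal.ofReal (t ^ (-γ - 1)) * (UFun p α ω v t)⁻¹) := by
        rw [lintegral_const_mul' _ _ hA]
        ring
    _ ≤ ENNReal.ofReal γ * A * hardyQuantity p α ω v r := by
        rw [hardyQuantity]
        gcongr
    _ ≤ _ := by gcongr; exact hK r hr

/-- If `U` is infinite the quantity vanishes, with the convention `∞ * 0 = 0`. Otherwise the part
of the integral over `(r, τ]` is elementary and the part over `(τ, ∞)` is the hypothesis. -/
lemma hardyQuantity_le (hαn : α < n) {r : ℝ} (hr : 0 < r) {K : ℝ≥0∞}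
    (hK : UFun p α ω v r ≠ ∞ → ∀ s τ, 0 < s → s < τ → r < τ →
      uFun p ω v s * ∫⁻ t in Ioi τ,
        ENNReal.ofReal (t ^ (-((n : ℝ) - α) - 1)) * (UFun p α ω v t)⁻¹ ≤ K) :
    hardyQuantity p α ω v r ≤ ENNReal.ofReal ((n : ℝ) - α)⁻¹ + K := by
  have hγ : (0 : ℝ) < n - α := by linarith
  by_cases htop : UFun p α ω v r = ∞
  · have : ∫⁻ t in Ioi r, ENNReal.ofReal (t ^ (-((n : ℝ) - α) - 1)) * (UFun p α ω v t)⁻¹ = 0 := by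
      rw [setLIntegral_congr_fun (g := fun _ => 0) measurableSet_Ioi, lintegral_zero]
      intro t ht
      simp [UFun_eq_top_of_lt hαn hr ht htop]
    rw [hardyQuantity, this, mul_zero]
    exact zero_le
  have hK' := hK htop
  set γ := (n : ℝ) - α with hγdef
  set J : ℝ → ℝ≥0∞ := fun t => ENNReal.ofReal (t ^ (-γ - 1)) * (UFun p α ω v t)⁻¹ with hJ
  have e : hardyQuantity p α ω v r
      = UFun p α ω v r * (ENNReal.ofReal (r ^ γ) * ∫⁻ t in Ioi r, J t) := by
    rw [hardyQuantity]; ring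
  rw [e]
  refine UFun_mul_le fun s τ hs hsτ hrτ => ?_
  set a := ENNReal.ofReal (τ ^ (-γ)) * uFun p ω v s with ha
  have hτ : 0 < τ := hr.trans hrτ
  have hnear : a * ∫⁻ t in Ioc r τ, J t ≤ ENNReal.ofReal γ⁻¹ * ENNReal.ofReal (r ^ (-γ)) := by
    calc a * ∫⁻ t in Ioc r τ, J t ≤ ∫⁻ t in Ioc r τ, a * J t := lintegral_const_mul_le _ _
      _ ≤ ∫⁻ t in Ioc r τ, ENNReal.ofReal (t ^ (-γ - 1)) := by
          refine setLIntegral_mono' measurableSet_Ioc fun t ht => ?_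
          have h1 : a ≤ UFun p α ω v t :=
            (le_UFun_self hs hsτ.le).trans (UFun_antitone ht.2)
          calc a * J t ≤ UFun p α ω v t * J t := by gcongr
            _ = ENNReal.ofReal (t ^ (-γ - 1)) * (UFun p α ω v t * (UFun p α ω v t)⁻¹) := by
                rw [hJ]; ring
            _ ≤ ENNReal.ofReal (t ^ (-γ - 1)) * 1 := by
                gcongr
                exact ENNReal.mul_inv_le_one _
            _ = _ := mul_one _
      _ ≤ ∫⁻ t in Ioi r, ENNReal.ofReal (t ^ (-γ - 1)) :=
          lintegral_mono_set Ioc_subset_Ioi_self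
      _ = _ := lintegral_Ioi_rpow hr hγ
  have hfar : ENNReal.ofReal (r ^ γ) * (a * ∫⁻ t in Ioi τ, J t) ≤ K := by
    calc _ = (ENNReal.ofReal (r ^ γ) * ENNReal.ofReal (τ ^ (-γ))) *
          (uFun p ω v s * ∫⁻ t in Ioi τ, J t) := by rw [ha]; ring
      _ ≤ (ENNReal.ofReal (r ^ γ) * ENNReal.ofReal (r ^ (-γ))) * K := by
          refine mul_le_mul' (mul_le_mul_right (ofReal_rpow_neg_le hr hrτ.le hγ) _) ?_
          exact hK' s τ hs hsτ hrτ
      _ = K := by rw [ofReal_rpow_mul_neg γ hr, one_mul]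
  rw [← Ioc_union_Ioi_eq_Ioi hrτ.le, lintegral_union measurableSet_Ioi (Ioc_disjoint_Ioi le_rfl)]
  calc _ = ENNReal.ofReal (r ^ γ) * (a * ∫⁻ t in Ioc r τ, J t) +
        ENNReal.ofReal (r ^ γ) * (a * ∫⁻ t in Ioi τ, J t) := by ring
    _ ≤ ENNReal.ofReal (r ^ γ) * (ENNReal.ofReal γ⁻¹ * ENNReal.ofReal (r ^ (-γ))) + K := by
        gcongr
    _ = ENNReal.ofReal γ⁻¹ * (ENNReal.ofReal (r ^ γ) * ENNReal.ofReal (r ^ (-γ))) + K := by ring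
    _ = _ := by rw [ofReal_rpow_mul_neg γ hr, mul_one]

/-- The test function depends on `r`, with uniform constants. Its mass in `B(0, t)` is at most
`1 / U(2t)`, up to a constant, so its maximal function has bounded quasinorm; the assumed inequality
for its potential is then the bound on the tail of `t ^ (α - n - 1) / U(t)`. -/
lemma exists_hardyQuantity_le (hp : 1 < p) (hpq : p < q) (hn : n ≠ 0) (hαn : α < n)
    (hvA : MuckenhouptAinfty v) (hvRD : ReverseDoubling (q * (1 - α / (n : ℝ))) v)
    (hω : IsContWeight ω) {C : ℝ≥0∞} (hC : C ≠ ∞)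
    (h : ∀ f : Rn n → ℝ, LocallyIntegrable f volume → (∀ x, 0 ≤ f x) →
      centralMorreyNorm p ω v (rieszPotential α f)
        ≤ C * centralMorreyNorm p ω v (fracMaximal α f)) :
    ∃ K : ℝ≥0∞, K ≠ ∞ ∧ ∀ r, 0 < r → hardyQuantity p α ω v r ≤ K := by
  have hγ : (0 : ℝ) < n - α := by linarith
  have hvm : AEMeasurable v volume := hvA.1.1.aestronglyMeasurable.aemeasurable
  obtain ⟨C₂, hC₂, hup⟩ := exists_centralMorreyNorm_le hp hpq hn hαn hvA hvRD
  obtain ⟨c, B, hc, hB, htest⟩ := exists_measure_ball_comparable hn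
  set γ := (n : ℝ) - α with hγdef
  set P := ENNReal.ofReal (2 ^ γ)
  have hP : P ≠ ∞ := ENNReal.ofReal_ne_top
  set K₁ := P * (C * (C₂ * (B * P))) with hK₁
  have hK₁' : K₁ ≠ ∞ := ENNReal.mul_ne_top hP (ENNReal.mul_ne_top hC
    (ENNReal.mul_ne_top hC₂ (ENNReal.mul_ne_top hB hP)))
  refine ⟨ENNReal.ofReal γ⁻¹ + c⁻¹ * (ENNReal.ofReal γ⁻¹ * K₁), ?_, fun r hr => ?_⟩
  · exact ENNReal.add_ne_top.2 ⟨ENNReal.ofReal_ne_top, ENNReal.mul_ne_top (ENNReal.inv_ne_top.2 hc)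
      (ENNReal.mul_ne_top ENNReal.ofReal_ne_top hK₁')⟩
  refine hardyQuantity_le hαn hr fun hUr s τ hs hsτ hrτ => ?_
  -- `1 / U`, cut off near the origin: a density has no mass at `0`, while `1 / U(0+)` may be
  -- positive
  set g : ℝ → ℝ := fun t => if r < t then (UFun p α ω v t)⁻¹.toReal else 0 with hg
  have hUinv : ∀ t, r < t → (UFun p α ω v t)⁻¹ ≠ ∞ := fun t ht =>
    ENNReal.inv_ne_top.2 (UFun_pos hω hvA.1 (hr.trans ht)).ne'
  have hg1 : ∀ t, r < t → ENNReal.ofReal (g t) = (UFun p α ω v t)⁻¹ := fun t ht => by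
    rw [hg]
    simp only [if_pos ht]
    exact ENNReal.ofReal_toReal (hUinv t ht)
  have hg2 : ∀ t, ENNReal.ofReal (g t) ≤ (UFun p α ω v t)⁻¹ := fun t => by
    by_cases ht : r < t
    · exact (hg1 t ht).le
    · simp [hg, ht]
  have hg0 : ∀ t, 0 ≤ g t := fun t => by
    simp only [hg]
    split_ifs <;> simp
  have hgmono : Monotone g := fun t t' htt' => by
    by_cases ht : r < t
    · simp only [hg, if_pos ht, if_pos (ht.trans_le htt')]
      exact ENNReal.toReal_mono (hUinv t' (ht.trans_le htt'))
        (ENNReal.inv_le_inv.2 (UFun_antitone htt'))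
    · simpa [hg, ht] using hg0 t'
  obtain ⟨f, hfloc, hfnn, hf⟩ := htest r g hr hgmono hg0 fun t ht => by simp [hg, not_lt.2 ht]
  have hfm : AEMeasurable f volume := hfloc.aestronglyMeasurable.aemeasurable
  have hM : ∀ s, 0 < s → uFun p ω v s * truncMaximal γ (wMeasure f) s ≤ B * P := by
    intro s hs
    simp only [truncMaximal, ENNReal.mul_iSup]
    refine iSup₂_le fun t ht => ?_
    have ht0 : 0 < t := hs.trans ht
    calc uFun p ω v s * (ENNReal.ofReal (t ^ (-γ)) * wMeasure f (Metric.ball 0 t))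
        ≤ uFun p ω v s * (P * ENNReal.ofReal ((2 * t) ^ (-γ)) *
            (B * (UFun p α ω v (2 * t))⁻¹)) := by
          rw [← ofReal_rpow_neg_eq_scale γ ht0 two_pos]
          refine mul_le_mul_right (mul_le_mul_right ((hf t ht0).2.trans ?_) _) _
          exact mul_le_mul_right (hg2 _) _
      _ = B * P * ((ENNReal.ofReal ((2 * t) ^ (-γ)) * uFun p ω v s) *
            (UFun p α ω v (2 * t))⁻¹) := by ring
      _ ≤ B * P * (UFun p α ω v (2 * t) * (UFun p α ω v (2 * t))⁻¹) := by
          gcongr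
          exact le_UFun_self hs (by linarith)
      _ ≤ B * P * 1 := by
          gcongr
          exact ENNReal.mul_inv_le_one _
      _ = _ := mul_one _
  have hI : uFun p ω v s * truncPotential γ (wMeasure f) s ≤ K₁ := by
    calc _ ≤ P * centralMorreyNorm p ω v (rieszPotential α f) :=
          uFun_mul_truncPotential_le (by linarith) hαn hvm hfm hs
      _ ≤ P * (C * centralMorreyNorm p ω v (fracMaximal α f)) := by
          gcongr
          exact h f hfloc hfnn
      _ ≤ _ := by
          rw [hK₁]
          gcongr
          exact (hup ω f hfm _).2 hM
  have : SFinite (wMeasure f) := by unfold wMeasure; infer_instance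
  have hcake := lintegral_Ioi_eq_truncPotential (wMeasure f) hγ hs
  have htail : c * ∫⁻ t in Ioi τ, ENNReal.ofReal (t ^ (-γ - 1)) * (UFun p α ω v t)⁻¹
      ≤ ENNReal.ofReal γ⁻¹ * truncPotential γ (wMeasure f) s := by
    rw [← hcake]
    calc _ ≤ ∫⁻ t in Ioi τ, c * (ENNReal.ofReal (t ^ (-γ - 1)) * (UFun p α ω v t)⁻¹) :=
          lintegral_const_mul_le _ _
      _ ≤ ∫⁻ t in Ioi τ, ENNReal.ofReal (t ^ (-γ - 1)) * wMeasure f (Metric.ball 0 t) := by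
          refine setLIntegral_mono' measurableSet_Ioi fun t ht => ?_
          rw [mul_left_comm]
          refine mul_le_mul_right ?_ _
          rw [← hg1 t (hrτ.trans ht)]
          exact (hf t (hr.trans (hrτ.trans ht))).1
      _ ≤ _ := lintegral_mono_set (Ioi_subset_Ioi hsτ.le)
  rw [mul_comm c⁻¹, ← div_eq_mul_inv, ENNReal.le_div_iff_mul_le (Or.inl hc) (Or.inr
    (ENNReal.mul_ne_top ENNReal.ofReal_ne_top hK₁'))]
  calc _ = uFun p ω v s * (c * ∫⁻ t in Ioi τ,
        ENNReal.ofReal (t ^ (-γ - 1)) * (UFun p α ω v t)⁻¹) := by ring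
    _ ≤ uFun p ω v s * (ENNReal.ofReal γ⁻¹ * truncPotential γ (wMeasure f) s) := by gcongr
    _ = ENNReal.ofReal γ⁻¹ * (uFun p ω v s * truncPotential γ (wMeasure f) s) := by ring
    _ ≤ _ := by gcongr

/-- The converse: a finite `sup_{r > 0}` of the quantity gives the norm inequality. -/
lemma exists_centralMorreyNorm_rieszPotential_le (hp : 1 < p) (hpq : p < q) (hn : n ≠ 0)
    (hαn : α < n) (hvA : MuckenhouptAinfty v)
    (hvRD : ReverseDoubling (q * (1 - α / (n : ℝ))) v) (hω : IsContWeight ω) {K : ℝ≥0∞}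
    (hK : K ≠ ∞) (hKr : ∀ r, 0 < r → hardyQuantity p α ω v r ≤ K) :
    ∃ C : ℝ≥0∞, C ≠ ∞ ∧ ∀ f : Rn n → ℝ, AEMeasurable f volume →
      centralMorreyNorm p ω v (rieszPotential α f)
        ≤ (C + 1) * centralMorreyNorm p ω v (fracMaximal α f) := by
  have hvm : AEMeasurable v volume := hvA.1.1.aestronglyMeasurable.aemeasurable
  obtain ⟨C₂, hC₂, hup⟩ := exists_centralMorreyNorm_le hp hpq hn hαn hvA hvRD
  set P := ENNReal.ofReal (2 ^ ((n : ℝ) - α)) * volume (Metric.ball (0 : Rn n) 1) ^ (1 - α / (n : ℝ))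
  have hP : P ≠ ∞ := ENNReal.mul_ne_top ENNReal.ofReal_ne_top (volume_unitBall_rpow_ne_top n _)
  set G := ENNReal.ofReal ((n : ℝ) - α)
  refine ⟨C₂ * (G * P * K), ENNReal.mul_ne_top hC₂ (ENNReal.mul_ne_top
    (ENNReal.mul_ne_top ENNReal.ofReal_ne_top hP) hK), fun f hf => ?_⟩
  set N := centralMorreyNorm p ω v (fracMaximal α f)
  by_cases hN : N = ∞
  · rw [hN, ENNReal.mul_top (by simp)]
    exact le_top
  have : SFinite (wMeasure f) := by unfold wMeasure; infer_instance
  refine ((hup ω f hf (G * (P * N) * K)).1 fun r hr => ?_).trans ?_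
  · exact uFun_mul_truncPotential_le_of_hardyQuantity_le hαn hω hvA.1 (ENNReal.mul_ne_top hP hN)
      hKr _ (fun s hs => uFun_mul_truncMaximal_le (by linarith) hn hvm hs) hr
  · calc C₂ * (G * (P * N) * K) = C₂ * (G * P * K) * N := by ring
      _ ≤ _ := by gcongr; exact le_self_add

end Main

end MorreyRiesz

theorem theorem6p4 (n : ℕ) (p q α : ℝ) (hp : 1 < p) (hpq : p < q) (hα : 0 < α) (hαn : α < n)
    (v : MorreyRiesz.Rn n → ℝ) (hvA : MorreyRiesz.MuckenhouptAinfty v)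
    (hvRD : MorreyRiesz.ReverseDoubling (q * (1 - α / (n : ℝ))) v)
    (ω : ℝ → ℝ) (hω : MorreyRiesz.IsContWeight ω) :
    (∃ C : ℝ≥0, 0 < C ∧ ∀ f : MorreyRiesz.Rn n → ℝ,
        LocallyIntegrable f volume → (∀ x, 0 ≤ f x) →
          MorreyRiesz.centralMorreyNorm p ω v (MorreyRiesz.rieszPotential α f)
              ≤ C * MorreyRiesz.centralMorreyNorm p ω v (MorreyRiesz.fracMaximal α f) ∧
          MorreyRiesz.centralMorreyNorm p ω v (MorreyRiesz.fracMaximal α f)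
              ≤ C * MorreyRiesz.centralMorreyNorm p ω v (MorreyRiesz.rieszPotential α f)) ↔
      (⨆ (r : ℝ) (_ : 0 < r),
          ENNReal.ofReal (r ^ ((n : ℝ) - α)) * MorreyRiesz.UFun p α ω v r *
            ∫⁻ t in Ioi r, ENNReal.ofReal (t ^ (α - (n : ℝ) - 1)) *
              (MorreyRiesz.UFun p α ω v t)⁻¹) < ∞ := by
  open MorreyRiesz in
  have hn : n ≠ 0 := by
    rintro rfl
    norm_num at hαn
    linarith
  have hsup : (⨆ (r : ℝ) (_ : 0 < r),
      ENNReal.ofReal (r ^ ((n : ℝ) - α)) * UFun p α ω v r *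
        ∫⁻ t in Ioi r, ENNReal.ofReal (t ^ (α - (n : ℝ) - 1)) * (UFun p α ω v t)⁻¹)
      = ⨆ (r : ℝ) (_ : 0 < r), hardyQuantity p α ω v r := by
    simp only [hardyQuantity, neg_sub]
  rw [hsup]
  constructor
  · rintro ⟨C, -, hC⟩
    obtain ⟨K, hK, hKr⟩ := exists_hardyQuantity_le hp hpq hn hαn hvA hvRD hω
      (C := C) ENNReal.coe_ne_top fun f hf hf0 => (hC f hf hf0).1
    exact (iSup₂_le hKr).trans_lt hK.lt_top
  · intro hK
    obtain ⟨C, hC, hI⟩ := exists_centralMorreyNorm_rieszPotential_le hp hpq hn hαn hvA hvRD hω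
      hK.ne fun r hr => le_iSup₂ (f := fun (r : ℝ) (_ : 0 < r) => hardyQuantity p α ω v r) r hr
    have hW : (volume (Metric.ball (0 : Rn n) 1) ^ (1 - α / (n : ℝ)))⁻¹ ≠ ∞ :=
      ENNReal.inv_ne_top.2 (volume_unitBall_rpow_ne_zero n _)
    lift C to ℝ≥0 using hC
    lift (volume (Metric.ball (0 : Rn n) 1) ^ (1 - α / (n : ℝ)))⁻¹ to ℝ≥0 using hW with W hWeq
    refine ⟨C + 1 + W, by positivity, fun f hf _ => ⟨?_, ?_⟩⟩
    · refine (hI f hf.aestronglyMeasurable.aemeasurable).trans ?_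
      push_cast
      exact mul_le_mul' le_self_add le_rfl
    · refine (centralMorreyNorm_fracMaximal_le (by linarith) hn hαn
        hf.aestronglyMeasurable.aemeasurable).trans ?_
      rw [← hWeq]
      push_cast
      gcongr
      exact le_add_self
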